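/- Let $\sigma>0$, $\beta\ge 0$, $\lambda_0>0$ and $\beta_C:=\sigma\sqrt{2\lambda_0}$. For a forward curve $\lambda:[0,\infty)\to\mathbb R$ that is twice differentiable with $\lambda(0)=\lambda_0$, put $$\Lambda(t):=2\beta^2(\lambda(t)-\lambda(0))+3\beta\lambda'(t)+\lambda''(t),$$ and for $v_0\in\mathbb R$ let $r(t)$ be the maximal solution, for $t\ge 0$, of $$r''(t)+3\beta r'(t)+2\beta^2r(t)=\sigma^2r(t)^2+2\beta^2\lambda_0+\Lambda(t),\qquad r(0)=\lambda_0,\quad r'(0)=v_0, \tag{1}$$ with explosion time $\tau_\infty\in(0,\infty]$, the supremum of the times up to which the solution exists and is finite (this maximal solution exists and is unique in the cases below). For $v_0=\lambda'(0)$, a function $r$ on $[0,T)$ solves (1) if and only if, for some $y$, the pair $(r,y)$ solves the system $r'=y-\beta r+\beta\lambda+\lambda'$, $y'=\sigma^2r^2-2\beta y$, $r(0)=\lambda(0)$, $y(0)=0$ on $[0,T)$. (i) Let $\beta<\beta_C$. The equation $$\tfrac12y'(x)+3\beta\sqrt{y(x)}=\sigma^2x^2-2\beta^2x+2\beta^2\lambda_0\quad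 (x\ge\lambda_0),\qquad y(\lambda_0)=0,$$ has a unique nonnegative solution $y$ on $[\lambda_0,\infty)$, it is positive on $(\lambda_0,\infty)$, and $$\bar\tau_\infty:=\int_{\lambda_0}^\infty\frac{dx}{\sqrt{y(x)}}<\infty.$$ If $\Lambda(t)\ge 0$ for all $t\ge 0$ and $v_0\ge 0$, then $\tau_\infty\le\bar\tau_\infty$ and $r(t)\to+\infty$ as $t\uparrow\tau_\infty$. If $\lambda(t)\equiv\lambda_0$ and $v_0=0$, then $\tau_\infty=\bar\tau_\infty$. (ii) Let $\beta\ge\beta_C$, $\lambda(t)\equiv\lambda_0$ and $v_0=0$. Then $\tau_\infty=\infty$, and $$\lim_{t\to\infty}r(t)=x_1:=\frac{\beta^2}{\sigma^2}\left(1-\sqrt{1-\frac{2\sigma^2\lambda_0}{\beta^2}}\right).$$ -/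

import Mathlib

open Set Filter Topology MeasureTheory
open scoped ENNReal

noncomputable section

/-- A forward short rate curve that is twice differentiable on `[0, ∞)`, one-sidedly at `0`. -/
def IsTwiceDifferentiableCurve (lam : ℝ → ℝ) : Prop :=
  DifferentiableOn ℝ lam (Ici 0) ∧ DifferentiableOn ℝ (derivWithin lam (Ici 0)) (Ici 0)

/-- `Λ(t) = 2β²(λ(t) - λ(0)) + 3β λ'(t) + λ''(t)`. -/
def bigLambda (β : ℝ) (lam : ℝ → ℝ) (t : ℝ) : ℝ :=
  2 * β ^ 2 * (lam t - lam 0) + 3 * β * derivWithin lam (Ici 0) t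
    + derivWithin (derivWithin lam (Ici 0)) (Ici 0) t

/-- `(r, y)` solves the deterministic short rate system on `[0, T)`:
`r' = y - β r + β λ + λ'`, `y' = σ² r² - 2β y`, `r(0) = λ(0)`, `y(0) = 0`. -/
structure IsShortRateSystem (σ β : ℝ) (lam : ℝ → ℝ) (T : ℝ≥0∞) (r y : ℝ → ℝ) : Prop where
  init_r : r 0 = lam 0
  init_y : y 0 = 0
  deriv_r : ∀ t : ℝ, 0 ≤ t → ENNReal.ofReal t < T →
    HasDerivWithinAt r (y t - β * r t + β * lam t + derivWithin lam (Ici 0) t) (Ici 0) t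
  deriv_y : ∀ t : ℝ, 0 ≤ t → ENNReal.ofReal t < T →
    HasDerivWithinAt y (σ ^ 2 * r t ^ 2 - 2 * β * y t) (Ici 0) t

/-- `r` solves `r'' + 3β r' + 2β² r = σ² r² + 2β² λ(0) + Λ(t)` on `[0, T)` with `r(0) = λ(0)`
and `r'(0) = v₀`. The function `p` is the derivative of `r`. -/
def IsRateSolution (σ β : ℝ) (lam : ℝ → ℝ) (v₀ : ℝ) (T : ℝ≥0∞) (r : ℝ → ℝ) : Prop :=
  r 0 = lam 0 ∧ ∃ p : ℝ → ℝ, p 0 = v₀ ∧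
    ∀ t : ℝ, 0 ≤ t → ENNReal.ofReal t < T →
      HasDerivWithinAt r (p t) (Ici 0) t ∧
      HasDerivWithinAt p
        (σ ^ 2 * r t ^ 2 + 2 * β ^ 2 * lam 0 + bigLambda β lam t
          - 3 * β * p t - 2 * β ^ 2 * r t) (Ici 0) t

/-- The explosion time: the supremum of the times up to which the solution exists and is finite. -/
def explosionTime (σ β : ℝ) (lam : ℝ → ℝ) (v₀ : ℝ) : ℝ≥0∞ :=
  sSup {T : ℝ≥0∞ | ∃ r : ℝ → ℝ, IsRateSolution σ β lam v₀ T r}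

/-- `r` is the maximal solution: it lives on the nonempty interval `[0, τ)` with `τ` the explosion
time, and every solution on some `[0, T)` agrees with it there. -/
def IsMaximalRateSolution (σ β : ℝ) (lam : ℝ → ℝ) (v₀ : ℝ) (r : ℝ → ℝ) : Prop :=
  0 < explosionTime σ β lam v₀ ∧
  IsRateSolution σ β lam v₀ (explosionTime σ β lam v₀) r ∧
  ∀ (T : ℝ≥0∞) (s : ℝ → ℝ), IsRateSolution σ β lam v₀ T s →
    ∀ t : ℝ, 0 ≤ t → ENNReal.ofReal t < T → s t = r t

/-- `y ≥ 0` solves `y'/2 + 3β √y = σ² x² - 2β² x + 2β² λ₀` on `[λ₀, ∞)` with `y(λ₀) = 0`. -/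
structure IsSpeedProfile (σ β lam₀ : ℝ) (y : ℝ → ℝ) : Prop where
  init : y lam₀ = 0
  nonneg : ∀ x : ℝ, lam₀ ≤ x → 0 ≤ y x
  ode : ∀ x : ℝ, lam₀ ≤ x → ∃ d : ℝ, HasDerivWithinAt y d (Ici lam₀) x ∧
    1 / 2 * d + 3 * β * √(y x) = σ ^ 2 * x ^ 2 - 2 * β ^ 2 * x + 2 * β ^ 2 * lam₀

/-- `∫_{λ₀}^∞ dx / √(y(x))`, as an element of `[0, ∞]`, with the integrand `∞` where `y = 0`. -/
def explosionBound (lam₀ : ℝ) (y : ℝ → ℝ) : ℝ≥0∞ :=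
  ∫⁻ x in Ioi lam₀, (ENNReal.ofReal √(y x))⁻¹

/-- The critical mean reversion `β_C = σ √(2 λ₀)`. -/
def criticalBeta (σ lam₀ : ℝ) : ℝ := σ * √(2 * lam₀)

/-- The smaller zero of `σ² x² - 2β² x + 2β² λ₀`, for `β ≥ β_C`. -/
def lowerFixedPoint (σ β lam₀ : ℝ) : ℝ :=
  β ^ 2 / σ ^ 2 * (1 - √(1 - 2 * σ ^ 2 * lam₀ / β ^ 2))

end

/-!
Substituting `q = r - λ` and `y = r' + β r - β λ - λ'` turns the short rate equation into the system
`q' = y - β q`, `y' = σ² (q + λ)² - 2β y`, whose right-hand side is continuous in time and locally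
Lipschitz in `(q, y)`. Truncating it to a box makes it bounded and globally Lipschitz, so the
Picard-Lindelöf theorem applies on arbitrarily long time intervals. Hence bounded solutions can be
continued, and a maximal solution with finite explosion time is unbounded
(`exists_maximal_solution`); since `y` is controlled by `r`, the function `r` itself is then
unbounded (`exists_isMaximalRateSolution`).

Below the critical mean reversion write `p = r'` and `Q(x) = σ² x² - 2β² x + 2β² λ₀`. Then
`Q(x) ≥ c x²` for some `c > 0`, and `p' + 3β p = Q(r) + Λ` shows that `r` increases. If `Z` is a
subsolution of the profile equation, `Z' / 2 + 3β √Z ≤ Q` and `Z(λ₀) = 0`, then `p² - Z(r)` is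
nondecreasing wherever it is negative, so `p ≥ √Z(r)` (`IsPhaseTrajectory.le_sq`). The change of
variables `x = r(t)` then bounds the lifetime of the trajectory by `∫ dx / √Z`
(`IsPhaseTrajectory.le_explosionBound`). The explicit subsolution `k² (x - λ₀) x²` has a finite
integral, so the solution for the flat curve explodes in finite time and runs through `[λ₀, ∞)`. Its
squared speed as a function of position is a speed profile
(`IsPhaseTrajectory.exists_isSpeedProfile`), every speed profile coincides with it
(`IsPhaseTrajectory.profile_eq_sq`), and the change of variables now gives the explosion time
exactly. The comparison with this profile bounds all the other explosion times.

At or above the critical mean reversion `Q` has real zeros `x₁ ≤ x₂` above `λ₀`. The trajectory for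
the flat curve stays in the triangle `λ₀ ≤ r`, `0 ≤ p < β (x₁ - r)`
(`IsPhaseTrajectory.mem_triangle`), so it is global and increasing, and its limit can only be `x₁`.
-/

/-! ### Maximal solutions of ordinary differential equations -/

/-- `x` solves `x' = F(t, x)`, `x(0) = x₀` on `[0, T)`. Nothing is asked of `x` elsewhere, except
for the value at `0` when `T = 0`. -/
def IsSolutionUpTo {E : Type*} [NormedAddCommGroup E] [NormedSpace ℝ E] (F : ℝ → E → E) (x₀ : E)
    (T : ℝ≥0∞) (x : ℝ → E) : Prop :=
  x 0 = x₀ ∧ ∀ t : ℝ, 0 ≤ t → ENNReal.ofReal t < T → HasDerivWithinAt x (F t (x t)) (Ici 0) t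

/-- On every `[0, T] × closedBall 0 n` the vector field `F` agrees with a vector field that is
continuous in time, bounded, and globally Lipschitz in space. -/
def IsTruncatable {E : Type*} [NormedAddCommGroup E] (F : ℝ → E → E) : Prop :=
  ∀ n T : ℝ, 0 ≤ n → 0 ≤ T → ∃ (G : ℝ → E → E) (K L : NNReal),
    (∀ t ∈ Icc 0 T, LipschitzWith K (G t)) ∧ (∀ x, ContinuousOn (G · x) (Icc 0 T)) ∧
    (∀ t ∈ Icc 0 T, ∀ x, ‖G t x‖ ≤ L) ∧ ∀ t ∈ Icc 0 T, ∀ x, ‖x‖ ≤ n → G t x = F t x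

section ODE

variable {E : Type*} [NormedAddCommGroup E] [NormedSpace ℝ E] {F : ℝ → E → E} {x₀ : E}

lemma ofReal_lt_of_le {s t : ℝ} {T : ℝ≥0∞} (hst : s ≤ t) (ht : ENNReal.ofReal t < T) :
    ENNReal.ofReal s < T :=
  (ENNReal.ofReal_le_ofReal hst).trans_lt ht

lemma IsSolutionUpTo.continuousOn {T : ℝ≥0∞} {x : ℝ → E} (hx : IsSolutionUpTo F x₀ T x) {t : ℝ}
    (ht : ENNReal.ofReal t < T) : ContinuousOn x (Icc 0 t) := fun s hs =>
  ((hx.2 s hs.1 (ofReal_lt_of_le hs.2 ht)).continuousWithinAt).mono Icc_subset_Ici_self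

/-- Two solutions agree at every time that both of them reach. -/
lemma IsSolutionUpTo.eq_of_lt (hF : IsTruncatable F) {T S : ℝ≥0∞} {x y : ℝ → E}
    (hx : IsSolutionUpTo F x₀ T x) (hy : IsSolutionUpTo F x₀ S y) {t : ℝ} (h0 : 0 ≤ t)
    (htT : ENNReal.ofReal t < T) (htS : ENNReal.ofReal t < S) : x t = y t := by
  have hxc := hx.continuousOn htT
  have hyc := hy.continuousOn htS
  obtain ⟨a, ha⟩ := isCompact_Icc.exists_bound_of_continuousOn hxc
  obtain ⟨b, hb⟩ := isCompact_Icc.exists_bound_of_continuousOn hyc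
  obtain ⟨G, K, L, hG, -, -, hGF⟩ := hF (max (max a b) 0) t (le_max_right _ _) h0
  have hxn : ∀ s ∈ Icc 0 t, ‖x s‖ ≤ max (max a b) 0 := fun s hs => by
    simp [ha s hs]
  have hyn : ∀ s ∈ Icc 0 t, ‖y s‖ ≤ max (max a b) 0 := fun s hs => by
    simp [hb s hs]
  refine ODE_solution_unique_of_mem_Icc_right (v := G) (s := fun _ => univ) (K := K)
    (fun s hs => (hG s (Ico_subset_Icc_self hs)).lipschitzOnWith) hxc (fun s hs => ?_)
    (fun _ _ => mem_univ _) hyc (fun s hs => ?_) (fun _ _ => mem_univ _) (hx.1.trans hy.1.symm)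
    (right_mem_Icc.2 h0)
  · rw [hGF s (Ico_subset_Icc_self hs) _ (hxn s (Ico_subset_Icc_self hs))]
    exact (hx.2 s hs.1 (ofReal_lt_of_le hs.2.le htT)).mono (Ici_subset_Ici.2 hs.1)
  · rw [hGF s (Ico_subset_Icc_self hs) _ (hyn s (Ico_subset_Icc_self hs))]
    exact (hy.2 s hs.1 (ofReal_lt_of_le hs.2.le htS)).mono (Ici_subset_Ici.2 hs.1)

/-- A bounded solution on a finite interval `[0, T)` extends beyond `T`: a truncated equation is
solvable up to time `T + 1`, and its solution stays in the region without truncation for a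
while after `T`. -/
lemma IsSolutionUpTo.exists_extension [CompleteSpace E] (hF : IsTruncatable F) {T : ℝ≥0∞}
    (hT : T ≠ ⊤) {x : ℝ → E} (hx : IsSolutionUpTo F x₀ T x) {n : ℝ} (h0 : ‖x₀‖ ≤ n)
    (hn : ∀ t : ℝ, 0 ≤ t → ENNReal.ofReal t < T → ‖x t‖ ≤ n) :
    ∃ (S : ℝ≥0∞) (z : ℝ → E), T < S ∧ IsSolutionUpTo F x₀ S z := by
  set a := T.toReal with ha
  have ha0 : 0 ≤ a := ENNReal.toReal_nonneg
  have hTa : T = ENNReal.ofReal a := (ENNReal.ofReal_toReal hT).symm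
  have hn0 : 0 ≤ n := (norm_nonneg _).trans h0
  have hlt : ∀ t : ℝ, t < a → 0 ≤ t → ENNReal.ofReal t < T := fun t ht h0 => by
    rw [hTa]; exact (ENNReal.ofReal_lt_ofReal_iff (h0.trans_lt ht)).2 ht
  obtain ⟨G, K, L, hGlip, hGcont, hGL, hGF⟩ := hF (n + 1) (a + 1) (by linarith) (by linarith)
  -- boundedness of `G` lets the ball of the Picard iteration be as large as the interval needs
  have hPL : IsPicardLindelof G (tmin := 0) (tmax := a + 1) ⟨0, le_rfl, by linarith⟩ x₀
      (L * Real.toNNReal (a + 1)) 0 L K :=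
    { lipschitzOnWith := fun t ht => (hGlip t ht).lipschitzOnWith
      continuousOn := fun y _ => hGcont y
      norm_le := fun t ht y _ => hGL t ht y
      mul_max_le := by
        simp only [NNReal.coe_mul, NNReal.coe_zero, sub_zero]
        rw [Real.coe_toNNReal _ (by linarith), max_eq_left (by linarith)] }
  obtain ⟨z, hz0, hz⟩ := hPL.exists_eq_forall_mem_Icc_hasDerivWithinAt₀
  have hz0 : z 0 = x₀ := hz0
  have hzc : ContinuousOn z (Icc 0 (a + 1)) := fun t ht => (hz t ht).continuousWithinAt
  have hzI : ∀ t : ℝ, 0 ≤ t → t < a + 1 → HasDerivWithinAt z (G t (z t)) (Ici 0) t :=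
    fun t h0 ht => (hz t ⟨h0, ht.le⟩).mono_of_mem_nhdsWithin (by
      rw [← Ici_inter_Iic]
      exact inter_mem self_mem_nhdsWithin (mem_nhdsWithin_of_mem_nhds (Iic_mem_nhds ht)))
  have hzx : ∀ t : ℝ, 0 ≤ t → t < a → z t = x t := fun t h0 hta => by
    have hmem : ∀ s ∈ Ico 0 t, s ∈ Icc 0 (a + 1) := fun s hs => ⟨hs.1, by linarith [hs.2]⟩
    refine ODE_solution_unique_of_mem_Icc_right (v := G) (s := fun _ => univ) (K := K)
      (fun s hs => (hGlip s (hmem s hs)).lipschitzOnWith)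
      (hzc.mono (Icc_subset_Icc le_rfl (by linarith))) (fun s hs => ?_) (fun _ _ => mem_univ _)
      (hx.continuousOn (hlt t hta h0)) (fun s hs => ?_) (fun _ _ => mem_univ _)
      (hz0.trans hx.1.symm) (right_mem_Icc.2 h0)
    · exact (hzI s hs.1 (by linarith [hs.2])).mono (Ici_subset_Ici.2 hs.1)
    · have hsT := hlt s (hs.2.trans hta) hs.1
      rw [hGF s (hmem s hs) _ ((hn s hs.1 hsT).trans (by linarith))]
      exact (hx.2 s hs.1 hsT).mono (Ici_subset_Ici.2 hs.1)
  have hzn : ∀ t : ℝ, 0 ≤ t → t < a → ‖z t‖ ≤ n := fun t h0 hta => by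
    rw [hzx t h0 hta]; exact hn t h0 (hlt t hta h0)
  have hza : ‖z a‖ ≤ n := by
    rcases ha0.eq_or_lt with h | h
    · rw [← h, hz0]; exact h0
    · have hc : Tendsto (fun t => ‖z t‖) (𝓝[Ico 0 a] a) (𝓝 ‖z a‖) :=
        ((hzc a ⟨ha0, by linarith⟩).mono
          (fun s hs => ⟨hs.1, by linarith [hs.2]⟩)).norm.tendsto
      have : (𝓝[Ico 0 a] a).NeBot := by
        rw [← mem_closure_iff_nhdsWithin_neBot, closure_Ico h.ne]
        exact right_mem_Icc.2 ha0
      exact le_of_tendsto hc (eventually_nhdsWithin_of_forall fun s hs => hzn s hs.1 hs.2)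
  obtain ⟨ε, hε, hεz⟩ : ∃ ε > 0, ∀ t, a ≤ t → t < a + ε → ‖z t‖ < n + 1 := by
    have hev : ∀ᶠ t in 𝓝[Icc 0 (a + 1)] a, ‖z t‖ < n + 1 :=
      (hzc a ⟨ha0, by linarith⟩).norm.eventually (gt_mem_nhds (by linarith))
    obtain ⟨ε, hε, h⟩ := Metric.mem_nhdsWithin_iff.1 hev
    refine ⟨min ε 1, by positivity, fun t h1 h2 => h ⟨?_, by linarith, ?_⟩⟩
    · rw [Metric.mem_ball, Real.dist_eq, abs_of_nonneg (by linarith)]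
      linarith [min_le_left ε 1]
    · linarith [min_le_right ε 1]
  refine ⟨ENNReal.ofReal (a + min ε 1), z, ?_, hz0, fun t h0 ht => ?_⟩
  · rw [hTa]
    have : 0 < min ε 1 := by positivity
    exact (ENNReal.ofReal_lt_ofReal_iff (by linarith)).2 (by linarith)
  · have ht' : t < a + min ε 1 := (ENNReal.ofReal_lt_ofReal_iff'.1 ht).1
    have h1 : t < a + 1 := ht'.trans_le (by linarith [min_le_right ε 1])
    rw [← hGF t ⟨h0, h1.le⟩]
    · exact hzI t h0 h1
    · rcases lt_or_ge t a with h | h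
      · linarith [hzn t h0 h]
      · exact (hεz t h (by linarith [min_le_left ε 1])).le

/-- A maximal solution exists, and if its interval of existence is finite then it is unbounded. -/
lemma exists_maximal_solution [CompleteSpace E] (hF : IsTruncatable F) (x₀ : E) {τ : ℝ≥0∞}
    (hτ : τ = sSup {T : ℝ≥0∞ | ∃ x, IsSolutionUpTo F x₀ T x}) :
    0 < τ ∧ ∃ x, IsSolutionUpTo F x₀ τ x ∧
      (τ ≠ ⊤ → ∀ n : ℝ, ∃ t : ℝ, 0 ≤ t ∧ ENNReal.ofReal t < τ ∧ n < ‖x t‖) := by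
  have hle : ∀ (T : ℝ≥0∞) (x : ℝ → E), IsSolutionUpTo F x₀ T x → T ≤ τ := fun T x hx => by
    rw [hτ]; exact le_sSup ⟨x, hx⟩
  have hpos : 0 < τ := by
    obtain ⟨S, z, hS, hz⟩ := IsSolutionUpTo.exists_extension (x := fun _ => x₀) hF
      ENNReal.zero_ne_top
      ⟨rfl, fun t _ ht => absurd ht not_lt_zero⟩ le_rfl (fun t _ ht => absurd ht not_lt_zero)
    exact hS.trans_le (hle S z hz)
  have hex : ∀ t : ℝ, ENNReal.ofReal t < τ →
      ∃ (x : ℝ → E) (T : ℝ≥0∞), ENNReal.ofReal t < T ∧ IsSolutionUpTo F x₀ T x := fun t ht => by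
    rw [hτ] at ht
    obtain ⟨T, ⟨x, hx⟩, hT⟩ := lt_sSup_iff.1 ht
    exact ⟨x, T, hT, hx⟩
  choose! X S hS hX using hex
  have hsol : IsSolutionUpTo F x₀ τ (fun t => X t t) := by
    refine ⟨(hX 0 (by simpa using hpos)).1, fun t h0 ht => ?_⟩
    obtain ⟨u, htu, huS⟩ := ENNReal.lt_iff_exists_real_btwn.1 (hS t ht)
    have htu' : t < u := (ENNReal.ofReal_lt_ofReal_iff'.1 huS.1).1
    refine ((hX t ht).2 t h0 (hS t ht)).congr_of_eventuallyEq ?_ rfl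
    filter_upwards [self_mem_nhdsWithin, mem_nhdsWithin_of_mem_nhds (Iio_mem_nhds htu')]
      with s hs0 hsu
    have hsS : ENNReal.ofReal s < S t := ofReal_lt_of_le (le_of_lt hsu) huS.2
    have hsτ := hsS.trans_le (hle _ _ (hX t ht))
    exact (hX s hsτ).eq_of_lt hF (hX t ht) hs0 (hS s hsτ) hsS
  refine ⟨hpos, _, hsol, fun htop n => ?_⟩
  by_contra! hcon
  obtain ⟨S', z, hS', hz⟩ := hsol.exists_extension hF htop (n := max n ‖x₀‖) (le_max_right _ _)
    (fun t h0 ht => (hcon t h0 ht).trans (le_max_left _ _))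
  exact absurd (hle S' z hz) (not_le.2 hS')

end ODE

/-! ### The short rate equation as a first-order system -/

/-- The vector field of the system for `(r - λ, y)`. Unlike the equation for `r`, it does not
contain the second derivative of `λ`, which need not be continuous. -/
def shortRateField (σ β : ℝ) (lam : ℝ → ℝ) (t : ℝ) (x : ℝ × ℝ) : ℝ × ℝ :=
  (x.2 - β * x.1, σ ^ 2 * (x.1 + lam t) ^ 2 - 2 * β * x.2)

/-- Projection of `u` to the interval `[-n, n]`. -/
def clip (n u : ℝ) : ℝ := max (-n) (min u n)

lemma abs_clip_le {n : ℝ} (hn : 0 ≤ n) (u : ℝ) : |clip n u| ≤ n :=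
  abs_le.2 ⟨le_max_left _ _, max_le (by linarith) (min_le_right _ _)⟩

lemma clip_of_abs_le {n u : ℝ} (h : |u| ≤ n) : clip n u = u := by
  rw [clip, min_eq_left (abs_le.1 h).2, max_eq_right (abs_le.1 h).1]

lemma abs_clip_sub_clip_le (n u v : ℝ) : |clip n u - clip n v| ≤ |u - v| := by
  unfold clip
  refine (abs_max_sub_max_le_max _ _ _ _).trans ?_
  rw [sub_self, abs_zero]
  refine max_le (abs_nonneg _) ((abs_min_sub_min_le_max _ _ _ _).trans ?_)
  rw [sub_self, abs_zero]
  exact max_le le_rfl (abs_nonneg _)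

lemma isTruncatable_shortRateField {σ β : ℝ} (hβ : 0 ≤ β) {lam : ℝ → ℝ}
    (hlam : ContinuousOn lam (Ici 0)) : IsTruncatable (shortRateField σ β lam) := by
  intro n T hn hT
  obtain ⟨M, hM⟩ := isCompact_Icc.exists_bound_of_continuousOn
    (hlam.mono (Icc_subset_Ici_self : Icc 0 T ⊆ Ici 0))
  have hM0 : 0 ≤ M := (norm_nonneg _).trans (hM 0 ⟨le_rfl, hT⟩)
  refine ⟨fun t x => shortRateField σ β lam t (clip n x.1, clip n x.2),
    NNReal.mk ((1 + β) + (σ ^ 2 * (2 * (n + M)) + 2 * β)) (by positivity),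
    NNReal.mk ((n + β * n) + (σ ^ 2 * (n + M) ^ 2 + 2 * β * n)) (by positivity), ?_, ?_, ?_, ?_⟩
  · intro t ht
    have hl := hM t ht
    rw [Real.norm_eq_abs] at hl
    refine LipschitzWith.of_dist_le_mul fun x z => ?_
    rw [dist_eq_norm, dist_eq_norm, NNReal.coe_mk]
    set d := ‖x - z‖ with hd
    have hd0 : 0 ≤ d := norm_nonneg _
    have h1 : |clip n x.1 - clip n z.1| ≤ d :=
      (abs_clip_sub_clip_le n _ _).trans (norm_fst_le (x - z))
    have h2 : |clip n x.2 - clip n z.2| ≤ d :=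
      (abs_clip_sub_clip_le n _ _).trans (norm_snd_le (x - z))
    have hx1 := abs_clip_le hn x.1
    have hz1 := abs_clip_le hn z.1
    simp only [shortRateField, Prod.mk_sub_mk, Prod.norm_mk, Real.norm_eq_abs]
    generalize clip n x.1 = a at *
    generalize clip n x.2 = b at *
    generalize clip n z.1 = a' at *
    generalize clip n z.2 = b' at *
    have e1 : |b - β * a - (b' - β * a')| ≤ (1 + β) * d := by
      have : b - β * a - (b' - β * a') = (b - b') - β * (a - a') := by ring
      rw [this]
      calc |(b - b') - β * (a - a')| ≤ |b - b'| + |β * (a - a')| := abs_sub _ _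
        _ = |b - b'| + β * |a - a'| := by rw [abs_mul, abs_of_nonneg hβ]
        _ ≤ d + β * d := by gcongr
        _ = _ := by ring
    have e2 : |σ ^ 2 * (a + lam t) ^ 2 - 2 * β * b - (σ ^ 2 * (a' + lam t) ^ 2 - 2 * β * b')|
        ≤ (σ ^ 2 * (2 * (n + M)) + 2 * β) * d := by
      have : σ ^ 2 * (a + lam t) ^ 2 - 2 * β * b - (σ ^ 2 * (a' + lam t) ^ 2 - 2 * β * b')
          = σ ^ 2 * ((a + lam t + (a' + lam t)) * (a - a')) - 2 * β * (b - b') := by ring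
      rw [this]
      calc _ ≤ |σ ^ 2 * ((a + lam t + (a' + lam t)) * (a - a'))| + |2 * β * (b - b')| :=
            abs_sub _ _
        _ = σ ^ 2 * (|a + lam t + (a' + lam t)| * |a - a'|) + 2 * β * |b - b'| := by
            rw [abs_mul, abs_mul, abs_mul (2 * β), abs_of_nonneg (sq_nonneg σ),
              abs_of_nonneg (by positivity : 0 ≤ 2 * β)]
        _ ≤ σ ^ 2 * ((2 * (n + M)) * d) + 2 * β * d := by
            have : |a + lam t + (a' + lam t)| ≤ 2 * (n + M) := by
              rw [abs_le] at *; constructor <;> linarith [hl.1, hl.2, hx1.1, hz1.1, hx1.2, hz1.2]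
            gcongr
        _ = _ := by ring
    refine max_le (e1.trans ?_) (e2.trans ?_)
    · rw [add_mul (1 + β)]; exact le_add_of_nonneg_right (by positivity)
    · rw [add_mul (1 + β)]; exact le_add_of_nonneg_left (by positivity)
  · intro x
    have := hlam.mono (Icc_subset_Ici_self : Icc 0 T ⊆ Ici 0)
    unfold shortRateField
    fun_prop
  · intro t ht x
    have hl := hM t ht
    rw [Real.norm_eq_abs] at hl
    have hx1 := abs_clip_le hn x.1
    have hx2 := abs_clip_le hn x.2
    simp only [shortRateField, Prod.norm_mk, Real.norm_eq_abs, NNReal.coe_mk]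
    generalize clip n x.1 = a at *
    generalize clip n x.2 = b at *
    have e1 : |b - β * a| ≤ n + β * n := by
      calc |b - β * a| ≤ |b| + |β * a| := abs_sub _ _
        _ = |b| + β * |a| := by rw [abs_mul, abs_of_nonneg hβ]
        _ ≤ _ := by gcongr
    have e2 : |σ ^ 2 * (a + lam t) ^ 2 - 2 * β * b| ≤ σ ^ 2 * (n + M) ^ 2 + 2 * β * n := by
      calc _ ≤ |σ ^ 2 * (a + lam t) ^ 2| + |2 * β * b| := abs_sub _ _
        _ = σ ^ 2 * |a + lam t| ^ 2 + 2 * β * |b| := by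
            rw [abs_mul, abs_mul (2 * β), abs_of_nonneg (sq_nonneg σ), abs_pow,
              abs_of_nonneg (by positivity : 0 ≤ 2 * β)]
        _ ≤ _ := by
            have : |a + lam t| ≤ n + M := (abs_add_le _ _).trans (add_le_add hx1 hl)
            gcongr
    refine max_le (e1.trans ?_) (e2.trans ?_)
    · exact le_add_of_nonneg_right (by positivity)
    · exact le_add_of_nonneg_left (by positivity)
  · intro t _ x hx
    simp only
    rw [clip_of_abs_le ((norm_fst_le x).trans hx), clip_of_abs_le ((norm_snd_le x).trans hx)]

/-- The two-dimensional system with an arbitrary initial value `y(0)`; the unknown is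
`y = r' + β r - β λ - λ'`. -/
lemma isRateSolution_iff_exists {σ β : ℝ} {lam : ℝ → ℝ} (hlam : IsTwiceDifferentiableCurve lam)
    (v₀ : ℝ) (T : ℝ≥0∞) (r : ℝ → ℝ) :
    IsRateSolution σ β lam v₀ T r ↔ r 0 = lam 0 ∧ ∃ y : ℝ → ℝ,
      y 0 = v₀ - derivWithin lam (Ici 0) 0 ∧ ∀ t : ℝ, 0 ≤ t → ENNReal.ofReal t < T →
        HasDerivWithinAt r (y t - β * r t + β * lam t + derivWithin lam (Ici 0) t) (Ici 0) t ∧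
        HasDerivWithinAt y (σ ^ 2 * r t ^ 2 - 2 * β * y t) (Ici 0) t := by
  have hl : ∀ t : ℝ, 0 ≤ t → HasDerivWithinAt lam (derivWithin lam (Ici 0) t) (Ici 0) t :=
    fun t ht => (hlam.1 t ht).hasDerivWithinAt
  have hl' : ∀ t : ℝ, 0 ≤ t → HasDerivWithinAt (derivWithin lam (Ici 0))
      (derivWithin (derivWithin lam (Ici 0)) (Ici 0) t) (Ici 0) t :=
    fun t ht => (hlam.2 t ht).hasDerivWithinAt
  refine and_congr_right fun hr0 => ⟨?_, ?_⟩
  · rintro ⟨p, hp0, hp⟩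
    refine ⟨fun t => p t + β * r t - β * lam t - derivWithin lam (Ici 0) t, ?_, fun t h0 ht => ?_⟩
    · simp only [hp0, hr0]; ring
    · obtain ⟨h1, h2⟩ := hp t h0 ht
      refine ⟨h1.congr_deriv (by ring), ?_⟩
      refine (((h2.add (h1.const_mul β)).sub ((hl t h0).const_mul β)).sub (hl' t h0)).congr_deriv ?_
      simp only [bigLambda]; ring
  · rintro ⟨y, hy0, hy⟩
    refine ⟨fun t => y t - β * r t + β * lam t + derivWithin lam (Ici 0) t, ?_, fun t h0 ht => ?_⟩
    · simp only [hy0, hr0]; ring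
    · obtain ⟨h1, h2⟩ := hy t h0 ht
      refine ⟨h1, ?_⟩
      refine (((h2.sub (h1.const_mul β)).add ((hl t h0).const_mul β)).add (hl' t h0)).congr_deriv ?_
      simp only [bigLambda]; ring

lemma exists_isShortRateSystem_iff {σ β : ℝ} {lam : ℝ → ℝ} (hlam : IsTwiceDifferentiableCurve lam)
    (T : ℝ≥0∞) (r : ℝ → ℝ) : (∃ y : ℝ → ℝ, IsShortRateSystem σ β lam T r y) ↔
      IsRateSolution σ β lam (derivWithin lam (Ici 0) 0) T r := by
  rw [isRateSolution_iff_exists hlam, sub_self]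
  constructor
  · rintro ⟨y, h⟩
    exact ⟨h.init_r, y, h.init_y, fun t h0 ht => ⟨h.deriv_r t h0 ht, h.deriv_y t h0 ht⟩⟩
  · rintro ⟨hr, y, hy, h⟩
    exact ⟨y, hr, hy, fun t h0 ht => (h t h0 ht).1, fun t h0 ht => (h t h0 ht).2⟩

lemma isRateSolution_iff_isSolutionUpTo {σ β : ℝ} {lam : ℝ → ℝ}
    (hlam : IsTwiceDifferentiableCurve lam) (v₀ : ℝ) (T : ℝ≥0∞) (r : ℝ → ℝ) :
    IsRateSolution σ β lam v₀ T r ↔ ∃ y : ℝ → ℝ, IsSolutionUpTo (shortRateField σ β lam)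
      (0, v₀ - derivWithin lam (Ici 0) 0) T (fun t => (r t - lam t, y t)) := by
  have hl : ∀ t : ℝ, 0 ≤ t → HasDerivWithinAt lam (derivWithin lam (Ici 0) t) (Ici 0) t :=
    fun t ht => (hlam.1 t ht).hasDerivWithinAt
  rw [isRateSolution_iff_exists hlam]
  constructor
  · rintro ⟨hr, y, hy, h⟩
    refine ⟨y, by simp [hr, hy], fun t h0 ht => ?_⟩
    refine (((h t h0 ht).1.sub (hl t h0)).prodMk (h t h0 ht).2).congr_deriv ?_
    simp only [shortRateField, Prod.mk.injEq]
    constructor <;> ring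
  · rintro ⟨y, h0, h⟩
    have h0' := Prod.mk.injEq .. ▸ h0
    refine ⟨by linarith [h0'.1], y, h0'.2, fun t h0 ht => ⟨?_, ?_⟩⟩
    · have h1 := (hasFDerivWithinAt_fst.comp_hasDerivWithinAt t (h t h0 ht) (mapsTo_univ _ _)).add
        (hl t h0)
      refine (h1.congr_deriv ?_).congr_of_mem (fun s _ => ?_) h0
      · simp [shortRateField]; ring
      · simp
    · have h1 := hasFDerivWithinAt_snd.comp_hasDerivWithinAt t (h t h0 ht) (mapsTo_univ _ _)
      refine (h1.congr_deriv ?_).congr_of_mem (fun s _ => ?_) h0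
      · simp [shortRateField]
      · simp

/-- The maximal solution exists; if its explosion time is finite then it is unbounded, since the
companion variable `y` solves a linear equation driven by `r²`. -/
lemma exists_isMaximalRateSolution {σ β : ℝ} (hβ : 0 ≤ β) {lam : ℝ → ℝ}
    (hlam : IsTwiceDifferentiableCurve lam) (v₀ : ℝ) :
    ∃ r : ℝ → ℝ, IsMaximalRateSolution σ β lam v₀ r ∧
      (explosionTime σ β lam v₀ ≠ ⊤ → ∀ M : ℝ, ∃ t : ℝ, 0 ≤ t ∧
        ENNReal.ofReal t < explosionTime σ β lam v₀ ∧ M < |r t|) := by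
  have hlc : ContinuousOn lam (Ici 0) := hlam.1.continuousOn
  have hF := isTruncatable_shortRateField (σ := σ) hβ hlc
  set τ := explosionTime σ β lam v₀ with hτ
  have hset : {T : ℝ≥0∞ | ∃ r, IsRateSolution σ β lam v₀ T r} =
      {T : ℝ≥0∞ | ∃ x, IsSolutionUpTo (shortRateField σ β lam)
        (0, v₀ - derivWithin lam (Ici 0) 0) T x} := by
    ext T
    simp only [mem_ofPred_eq, isRateSolution_iff_isSolutionUpTo hlam]
    constructor
    · rintro ⟨r, y, h⟩; exact ⟨_, h⟩
    · rintro ⟨x, h⟩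
      refine ⟨fun t => (x t).1 + lam t, fun t => (x t).2, ?_⟩
      simpa using h
  obtain ⟨hpos, x, hx, hunb⟩ := exists_maximal_solution hF (0, v₀ - derivWithin lam (Ici 0) 0)
    (τ := τ) (by rw [hτ, explosionTime, hset])
  have hr : IsRateSolution σ β lam v₀ τ (fun t => (x t).1 + lam t) :=
    (isRateSolution_iff_isSolutionUpTo hlam ..).2 ⟨fun t => (x t).2, by simpa using hx⟩
  refine ⟨fun t => (x t).1 + lam t, ⟨hpos, hr, fun T s hs t h0 ht => ?_⟩, fun htop M => ?_⟩
  · obtain ⟨y, hy⟩ := (isRateSolution_iff_isSolutionUpTo hlam ..).1 hs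
    have hTτ : T ≤ τ := le_sSup ⟨s, hs⟩
    have := congrArg Prod.fst (hy.eq_of_lt hF hx h0 ht (ht.trans_le hTτ))
    simp only at this
    linarith
  · by_contra! hM
    set a := τ.toReal
    have ha0 : 0 ≤ a := ENNReal.toReal_nonneg
    have hta : ∀ t : ℝ, ENNReal.ofReal t < τ → t ≤ a := fun t ht =>
      (ENNReal.ofReal_le_iff_le_toReal htop).1 ht.le
    obtain ⟨N, hN⟩ := isCompact_Icc.exists_bound_of_continuousOn
      (hlc.mono (Icc_subset_Ici_self : Icc 0 a ⊆ Ici 0))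
    have hM0 : 0 ≤ M := (abs_nonneg _).trans (hM 0 le_rfl (by simpa using hpos))
    -- `exp (2βt) y` has the bounded derivative `exp (2βt) σ² r²`
    have hy : ∀ t : ℝ, 0 ≤ t → ENNReal.ofReal t < τ →
        |(x t).2| ≤ |(x 0).2| + Real.exp (2 * β * a) * (σ ^ 2 * M ^ 2) * a := by
      intro t h0 ht
      have hd : ∀ s ∈ Icc 0 t, HasDerivWithinAt (fun s => Real.exp (2 * β * s) * (x s).2)
          (Real.exp (2 * β * s) * (σ ^ 2 * ((x s).1 + lam s) ^ 2)) (Icc 0 t) s := by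
        intro s hs
        have h1 := hasFDerivWithinAt_snd.comp_hasDerivWithinAt s
          (hx.2 s hs.1 (ofReal_lt_of_le hs.2 ht)) (mapsTo_univ _ _)
        have h2 : HasDerivWithinAt (fun s : ℝ => Real.exp (2 * β * s))
            (Real.exp (2 * β * s) * (2 * β)) (Ici 0) s :=
          (((hasDerivAt_id s).const_mul (2 * β)).exp).hasDerivWithinAt.congr_deriv (by simp)
        refine ((h2.mul h1).congr_deriv ?_).mono Icc_subset_Ici_self
        simp [shortRateField]; ring
      have hb := (convex_Icc 0 t).norm_image_sub_le_of_norm_hasDerivWithin_le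
        (C := Real.exp (2 * β * a) * (σ ^ 2 * M ^ 2)) hd (fun s hs => ?_)
        (left_mem_Icc.2 h0) (right_mem_Icc.2 h0)
      · simp only [mul_zero, Real.exp_zero, one_mul, sub_zero, Real.norm_eq_abs,
          abs_of_nonneg h0] at hb
        have h1 : |Real.exp (2 * β * t) * (x t).2| ≤
            |(x 0).2| + Real.exp (2 * β * a) * (σ ^ 2 * M ^ 2) * t := by
          have := abs_sub_abs_le_abs_sub (Real.exp (2 * β * t) * (x t).2) (x 0).2
          linarith
        have h2 : |(x t).2| ≤ |Real.exp (2 * β * t) * (x t).2| := by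
          rw [abs_mul, abs_of_pos (Real.exp_pos _)]
          exact le_mul_of_one_le_left (abs_nonneg _) (Real.one_le_exp (by positivity))
        have h3 : Real.exp (2 * β * a) * (σ ^ 2 * M ^ 2) * t ≤
            Real.exp (2 * β * a) * (σ ^ 2 * M ^ 2) * a := by
          have := hta t ht
          gcongr
        linarith
      · have h1 := hM s hs.1 (ofReal_lt_of_le hs.2 ht)
        rw [Real.norm_eq_abs, abs_mul, abs_of_pos (Real.exp_pos _), abs_mul,
          abs_of_nonneg (sq_nonneg σ), abs_pow]
        have := hs.2.trans (hta t ht)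
        gcongr
    obtain ⟨t, h0, ht, hlt⟩ := hunb htop
      (max (M + N) (|(x 0).2| + Real.exp (2 * β * a) * (σ ^ 2 * M ^ 2) * a))
    refine absurd hlt (not_lt.2 ?_)
    rw [Prod.norm_def]
    refine max_le_max ?_ (hy t h0 ht)
    have h1 := hM t h0 ht
    have h2 := hN t ⟨h0, hta t ht⟩
    calc ‖(x t).1‖ = |((x t).1 + lam t) - lam t| := by simp
      _ ≤ |(x t).1 + lam t| + |lam t| := abs_sub _ _
      _ ≤ M + N := add_le_add h1 h2

/-! ### Differential inequalities on an interval -/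

/-- If `f' + a f = g ≥ 0` then `exp (a t) f(t)` does not decrease. -/
lemma le_exp_mul_of_hasDerivWithinAt {f g : ℝ → ℝ} {a t : ℝ} (ht : 0 ≤ t)
    (hf : ∀ s ∈ Icc 0 t, HasDerivWithinAt f (g s - a * f s) (Icc 0 t) s)
    (hg : ∀ s ∈ Ioo 0 t, 0 ≤ g s) : f 0 ≤ Real.exp (a * t) * f t := by
  have hd : ∀ s ∈ Icc 0 t, HasDerivWithinAt (fun s => Real.exp (a * s) * f s)
      (Real.exp (a * s) * g s) (Icc 0 t) s := fun s hs => by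
    have h2 : HasDerivWithinAt (fun s : ℝ => Real.exp (a * s)) (Real.exp (a * s) * a) (Icc 0 t) s :=
      (((hasDerivAt_id s).const_mul a).exp).hasDerivWithinAt.congr_deriv (by simp)
    exact (h2.mul (hf s hs)).congr_deriv (by ring)
  have := monotoneOn_of_hasDerivWithinAt_nonneg (convex_Icc 0 t)
    (fun s hs => (hd s hs).continuousWithinAt)
    (fun s hs => (hd s (interior_subset hs)).mono interior_subset)
    (fun s hs => by
      rw [interior_Icc] at hs
      have := hg s hs
      positivity) (left_mem_Icc.2 ht) (right_mem_Icc.2 ht) ht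
  simpa using this

lemma lt_exp_mul_of_hasDerivWithinAt {f g : ℝ → ℝ} {a t : ℝ} (ht : 0 < t)
    (hf : ∀ s ∈ Icc 0 t, HasDerivWithinAt f (g s - a * f s) (Icc 0 t) s)
    (hg : ∀ s ∈ Ioo 0 t, 0 < g s) : f 0 < Real.exp (a * t) * f t := by
  have hd : ∀ s ∈ Icc 0 t, HasDerivWithinAt (fun s => Real.exp (a * s) * f s)
      (Real.exp (a * s) * g s) (Icc 0 t) s := fun s hs => by
    have h2 : HasDerivWithinAt (fun s : ℝ => Real.exp (a * s)) (Real.exp (a * s) * a) (Icc 0 t) s :=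
      (((hasDerivAt_id s).const_mul a).exp).hasDerivWithinAt.congr_deriv (by simp)
    exact (h2.mul (hf s hs)).congr_deriv (by ring)
  have := strictMonoOn_of_hasDerivWithinAt_pos (convex_Icc 0 t)
    (fun s hs => (hd s hs).continuousWithinAt)
    (fun s hs => (hd s (interior_subset hs)).mono interior_subset)
    (fun s hs => by
      rw [interior_Icc] at hs
      have := hg s hs
      positivity) (left_mem_Icc.2 ht.le) (right_mem_Icc.2 ht.le) ht
  simpa using this

/-- A function that starts nonnegative stays so if its derivative is nonnegative wherever the
function itself is negative. -/
lemma nonneg_of_hasDerivWithinAt_of_neg {w w' : ℝ → ℝ} {t : ℝ} (ht : 0 ≤ t)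
    (hw : ∀ s ∈ Icc 0 t, HasDerivWithinAt w (w' s) (Icc 0 t) s) (h0 : 0 ≤ w 0)
    (hneg : ∀ s ∈ Icc 0 t, w s < 0 → 0 ≤ w' s) : 0 ≤ w t := by
  by_contra! hlt
  have hc : ContinuousOn w (Icc 0 t) := fun s hs => (hw s hs).continuousWithinAt
  have hcpt : IsCompact (Icc 0 t ∩ w ⁻¹' Ici 0) :=
    isCompact_Icc.of_isClosed_subset (hc.preimage_isClosed_of_isClosed isClosed_Icc isClosed_Ici)
      inter_subset_left
  -- the last time at which `w` is nonnegative
  obtain ⟨m, ⟨hm, hwm⟩, hmax⟩ := hcpt.exists_isGreatest ⟨0, left_mem_Icc.2 ht, h0⟩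
  have hsub : Icc m t ⊆ Icc 0 t := Icc_subset_Icc hm.1 le_rfl
  have hmono := monotoneOn_of_hasDerivWithinAt_nonneg (convex_Icc m t) (hc.mono hsub)
    (fun s hs => (hw s (hsub (interior_subset hs))).mono (interior_subset.trans hsub))
    (fun s hs => by
      rw [interior_Icc] at hs
      have hs' : s ∈ Icc 0 t := ⟨hm.1.trans hs.1.le, hs.2.le⟩
      refine hneg s hs' ?_
      by_contra! h
      exact absurd (hmax ⟨hs', h⟩) (not_le.2 hs.1)) (left_mem_Icc.2 hm.2)
    (right_mem_Icc.2 hm.2) hm.2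
  exact absurd (le_trans hwm hmono) (not_le.2 hlt)

/-! ### Trajectories in the phase plane -/

/-- The pair `(r, p)` with `p = r'` solves `r'' + 3β r' = σ² r² - 2β² r + 2β² λ₀ + Λ(t)` on
`[0, T)`, with `r(0) = λ₀` and `p(0) = v₀`. -/
structure IsPhaseTrajectory (σ β lam₀ v₀ : ℝ) (Λ : ℝ → ℝ) (T : ℝ≥0∞) (r p : ℝ → ℝ) : Prop where
  init_r : r 0 = lam₀
  init_p : p 0 = v₀
  deriv_r : ∀ t : ℝ, 0 ≤ t → ENNReal.ofReal t < T → HasDerivWithinAt r (p t) (Ici 0) t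
  deriv_p : ∀ t : ℝ, 0 ≤ t → ENNReal.ofReal t < T → HasDerivWithinAt p
    (σ ^ 2 * r t ^ 2 - 2 * β ^ 2 * r t + 2 * β ^ 2 * lam₀ + Λ t - 3 * β * p t) (Ici 0) t

lemma IsRateSolution.exists_isPhaseTrajectory {σ β v₀ : ℝ} {lam r : ℝ → ℝ} {T : ℝ≥0∞}
    (h : IsRateSolution σ β lam v₀ T r) :
    ∃ p, IsPhaseTrajectory σ β (lam 0) v₀ (bigLambda β lam) T r p := by
  obtain ⟨h0, p, hp0, hp⟩ := h
  exact ⟨p, h0, hp0, fun t h0 ht => (hp t h0 ht).1,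
    fun t h0 ht => (hp t h0 ht).2.congr_deriv (by ring)⟩

lemma bigLambda_const (β lam₀ t : ℝ) : bigLambda β (fun _ => lam₀) t = 0 := by
  have h : derivWithin (fun _ : ℝ => lam₀) (Ici 0) = fun _ => 0 := by
    funext s; simp
  simp [bigLambda, h]

lemma isTwiceDifferentiableCurve_const (lam₀ : ℝ) :
    IsTwiceDifferentiableCurve (fun _ => lam₀) := by
  have h : derivWithin (fun _ : ℝ => lam₀) (Ici 0) = fun _ => 0 := by
    funext s; simp
  exact ⟨differentiableOn_const _, by rw [h]; exact differentiableOn_const _⟩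

/-- Below the critical mean reversion, `σ² x² - 2β² x + 2β² λ₀ ≥ c x²` with
`c = σ² - β² / (2λ₀) > 0`; the difference of the two sides is `β² / (2λ₀) (x - 2λ₀)²`. -/
lemma exists_mul_sq_le_of_lt_criticalBeta {σ β lam₀ : ℝ} (hβ : 0 ≤ β) (hlam₀ : 0 < lam₀)
    (h : β < criticalBeta σ lam₀) :
    ∃ c > 0, ∀ x : ℝ, c * x ^ 2 ≤ σ ^ 2 * x ^ 2 - 2 * β ^ 2 * x + 2 * β ^ 2 * lam₀ := by
  have h1 : β ^ 2 < σ ^ 2 * (2 * lam₀) := by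
    have := pow_lt_pow_left₀ h hβ two_ne_zero
    rwa [criticalBeta, mul_pow, Real.sq_sqrt (by positivity)] at this
  refine ⟨σ ^ 2 - β ^ 2 / (2 * lam₀), ?_, fun x => ?_⟩
  · rwa [gt_iff_lt, sub_pos, div_lt_iff₀ (by positivity)]
  have h2 : σ ^ 2 * x ^ 2 - 2 * β ^ 2 * x + 2 * β ^ 2 * lam₀ - (σ ^ 2 - β ^ 2 / (2 * lam₀)) * x ^ 2
      = β ^ 2 / (2 * lam₀) * (x - 2 * lam₀) ^ 2 := by
    field_simp; ring
  have h3 : 0 ≤ β ^ 2 / (2 * lam₀) * (x - 2 * lam₀) ^ 2 := by positivity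
  linarith

/-- The set of positive times before `T`. -/
def positiveTimes (T : ℝ≥0∞) : Set ℝ := {t | 0 < t ∧ ENNReal.ofReal t < T}

lemma positiveTimes_top : positiveTimes ⊤ = Ioi 0 := by
  ext t; simp [positiveTimes]

lemma positiveTimes_ofReal (a : ℝ) : positiveTimes (ENNReal.ofReal a) = Ioo 0 a := by
  ext t
  simp only [positiveTimes, mem_ofPred_eq, mem_Ioo]
  refine and_congr_right fun ht => ?_
  rw [ENNReal.ofReal_lt_ofReal_iff']
  exact ⟨fun h => h.1, fun h => ⟨h, ht.trans h⟩⟩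

lemma measurableSet_positiveTimes (T : ℝ≥0∞) : MeasurableSet (positiveTimes T) := by
  rcases eq_or_ne T ⊤ with rfl | hT
  · rw [positiveTimes_top]; exact measurableSet_Ioi
  · rw [← ENNReal.ofReal_toReal hT, positiveTimes_ofReal]; exact measurableSet_Ioo

lemma volume_positiveTimes (T : ℝ≥0∞) : volume (positiveTimes T) = T := by
  rcases eq_or_ne T ⊤ with rfl | hT
  · rw [positiveTimes_top, Real.volume_Ioi]
  · conv_lhs => rw [← ENNReal.ofReal_toReal hT]
    rw [positiveTimes_ofReal, Real.volume_Ioo, sub_zero, ENNReal.ofReal_toReal hT]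

namespace IsPhaseTrajectory

variable {σ β lam₀ v₀ c : ℝ} {Λ r p Z : ℝ → ℝ} {T : ℝ≥0∞}

lemma hasDerivWithinAt_r (h : IsPhaseTrajectory σ β lam₀ v₀ Λ T r p) {t : ℝ}
    (ht : ENNReal.ofReal t < T) : ∀ s ∈ Icc 0 t, HasDerivWithinAt r (p s) (Icc 0 t) s :=
  fun s hs => (h.deriv_r s hs.1 (ofReal_lt_of_le hs.2 ht)).mono Icc_subset_Ici_self

lemma hasDerivWithinAt_p (h : IsPhaseTrajectory σ β lam₀ v₀ Λ T r p) {t : ℝ}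
    (ht : ENNReal.ofReal t < T) : ∀ s ∈ Icc 0 t, HasDerivWithinAt p
      (σ ^ 2 * r s ^ 2 - 2 * β ^ 2 * r s + 2 * β ^ 2 * lam₀ + Λ s - 3 * β * p s) (Icc 0 t) s :=
  fun s hs => (h.deriv_p s hs.1 (ofReal_lt_of_le hs.2 ht)).mono Icc_subset_Ici_self

lemma nonneg (h : IsPhaseTrajectory σ β lam₀ v₀ Λ T r p) (hv₀ : 0 ≤ v₀) {t : ℝ} (h0 : 0 ≤ t)
    (ht : ENNReal.ofReal t < T)
    (hq : ∀ s ∈ Ioo 0 t, 0 ≤ σ ^ 2 * r s ^ 2 - 2 * β ^ 2 * r s + 2 * β ^ 2 * lam₀ + Λ s) :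
    0 ≤ p t := by
  have := le_exp_mul_of_hasDerivWithinAt h0 (h.hasDerivWithinAt_p ht) hq
  rw [h.init_p] at this
  exact nonneg_of_mul_nonneg_right (hv₀.trans this) (Real.exp_pos _)

lemma le_of_nonneg (h : IsPhaseTrajectory σ β lam₀ v₀ Λ T r p) {s t : ℝ} (h0 : 0 ≤ s) (hst : s ≤ t)
    (ht : ENNReal.ofReal t < T) (hp : ∀ u ∈ Ioo 0 t, 0 ≤ p u) : r s ≤ r t :=
  monotoneOn_of_hasDerivWithinAt_nonneg (convex_Icc 0 t)
    (fun u hu => (h.hasDerivWithinAt_r ht u hu).continuousWithinAt)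
    (fun u hu => (h.hasDerivWithinAt_r ht u (interior_subset hu)).mono interior_subset)
    (fun u hu => hp u (by rwa [interior_Icc] at hu)) ⟨h0, hst⟩ ⟨h0.trans hst, le_rfl⟩ hst

lemma lam₀_le (h : IsPhaseTrajectory σ β lam₀ v₀ Λ T r p) (hΛ : ∀ t, 0 ≤ t → 0 ≤ Λ t)
    (hv₀ : 0 ≤ v₀) (hc : 0 < c)
    (hq : ∀ x : ℝ, c * x ^ 2 ≤ σ ^ 2 * x ^ 2 - 2 * β ^ 2 * x + 2 * β ^ 2 * lam₀)
    {t : ℝ} (h0 : 0 ≤ t) (ht : ENNReal.ofReal t < T) : lam₀ ≤ r t := by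
  rw [← h.init_r]
  refine h.le_of_nonneg le_rfl h0 ht fun u hu =>
    h.nonneg hv₀ hu.1.le (ofReal_lt_of_le hu.2.le ht) fun s hs => ?_
  have h1 := hΛ s hs.1.le
  have h2 := hq (r s)
  have h3 : 0 ≤ c * r s ^ 2 := by positivity
  linarith

lemma pos (h : IsPhaseTrajectory σ β lam₀ v₀ Λ T r p) (hlam₀ : 0 < lam₀)
    (hΛ : ∀ t, 0 ≤ t → 0 ≤ Λ t) (hv₀ : 0 ≤ v₀) (hc : 0 < c)
    (hq : ∀ x : ℝ, c * x ^ 2 ≤ σ ^ 2 * x ^ 2 - 2 * β ^ 2 * x + 2 * β ^ 2 * lam₀)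
    {t : ℝ} (h0 : 0 < t) (ht : ENNReal.ofReal t < T) : 0 < p t := by
  have := lt_exp_mul_of_hasDerivWithinAt h0 (h.hasDerivWithinAt_p ht) fun s hs => by
    have h1 := hΛ s hs.1.le
    have h2 := hq (r s)
    have h3 := hlam₀.trans_le (h.lam₀_le hΛ hv₀ hc hq hs.1.le (ofReal_lt_of_le hs.2.le ht))
    have h4 : 0 < c * r s ^ 2 := by positivity
    linarith
  rw [h.init_p] at this
  exact pos_of_mul_pos_right (hv₀.trans_lt this) (Real.exp_pos _).le

lemma strictMonoOn (h : IsPhaseTrajectory σ β lam₀ v₀ Λ T r p) (hlam₀ : 0 < lam₀)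
    (hΛ : ∀ t, 0 ≤ t → 0 ≤ Λ t) (hv₀ : 0 ≤ v₀) (hc : 0 < c)
    (hq : ∀ x : ℝ, c * x ^ 2 ≤ σ ^ 2 * x ^ 2 - 2 * β ^ 2 * x + 2 * β ^ 2 * lam₀) :
    StrictMonoOn r {t | 0 ≤ t ∧ ENNReal.ofReal t < T} := by
  rintro s ⟨hs0, -⟩ t ⟨ht0, ht⟩ hst
  refine strictMonoOn_of_hasDerivWithinAt_pos (convex_Icc 0 t)
    (fun u hu => (h.hasDerivWithinAt_r ht u hu).continuousWithinAt)
    (fun u hu => (h.hasDerivWithinAt_r ht u (interior_subset hu)).mono interior_subset)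
    (fun u hu => ?_) ⟨hs0, hst.le⟩ ⟨ht0, le_rfl⟩ hst
  rw [interior_Icc] at hu
  exact h.pos hlam₀ hΛ hv₀ hc hq hu.1 (ofReal_lt_of_le hu.2.le ht)

/-- The derivative of `p² - Z(r)` along a trajectory, where `d = Z'`. -/
lemma hasDerivWithinAt_sq_sub (h : IsPhaseTrajectory σ β lam₀ v₀ Λ T r p)
    {d : ℝ → ℝ} {t : ℝ} (ht : ENNReal.ofReal t < T) (hr : ∀ s ∈ Icc 0 t, lam₀ ≤ r s)
    (hZ : ∀ x, lam₀ ≤ x → HasDerivWithinAt Z (d x) (Ici lam₀) x) {s : ℝ} (hs : s ∈ Icc 0 t) :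
    HasDerivWithinAt (fun s => p s ^ 2 - Z (r s)) (2 * p s * (σ ^ 2 * r s ^ 2 - 2 * β ^ 2 * r s
      + 2 * β ^ 2 * lam₀ + Λ s - 3 * β * p s) - d (r s) * p s) (Icc 0 t) s := by
  have h1 := (h.hasDerivWithinAt_p ht s hs).pow 2
  have h2 := (hZ (r s) (hr s hs)).comp s (h.hasDerivWithinAt_r ht s hs) (fun u hu => hr u hu)
  exact (h1.sub h2).congr_deriv (by push_cast; ring)

/-- Comparison with a subsolution `Z` of the profile equation. The derivative of `p² - Z(r)` is at
least `2pΛ + 6βp(√Z(r) - p)`, which is nonnegative where `p² < Z(r)`. -/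
lemma le_sq (h : IsPhaseTrajectory σ β lam₀ v₀ Λ T r p) (hβ : 0 ≤ β) (hlam₀ : 0 < lam₀)
    (hΛ : ∀ t, 0 ≤ t → 0 ≤ Λ t) (hv₀ : 0 ≤ v₀) (hc : 0 < c)
    (hq : ∀ x : ℝ, c * x ^ 2 ≤ σ ^ 2 * x ^ 2 - 2 * β ^ 2 * x + 2 * β ^ 2 * lam₀)
    (hZ0 : Z lam₀ = 0)
    (hZ : ∀ x, lam₀ ≤ x → ∃ d, HasDerivWithinAt Z d (Ici lam₀) x ∧
      1 / 2 * d + 3 * β * √(Z x) ≤ σ ^ 2 * x ^ 2 - 2 * β ^ 2 * x + 2 * β ^ 2 * lam₀)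
    {t : ℝ} (h0 : 0 ≤ t) (ht : ENNReal.ofReal t < T) : Z (r t) ≤ p t ^ 2 := by
  choose! d hd hdle using hZ
  have hr : ∀ s ∈ Icc 0 t, lam₀ ≤ r s := fun s hs =>
    h.lam₀_le hΛ hv₀ hc hq hs.1 (ofReal_lt_of_le hs.2 ht)
  have hp : ∀ s ∈ Icc 0 t, 0 ≤ p s := fun s hs => by
    rcases hs.1.eq_or_lt with h' | h'
    · rw [← h', h.init_p]; exact hv₀
    · exact (h.pos hlam₀ hΛ hv₀ hc hq h' (ofReal_lt_of_le hs.2 ht)).le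
  have := nonneg_of_hasDerivWithinAt_of_neg h0
    (fun s hs => h.hasDerivWithinAt_sq_sub ht hr hd hs)
    (by simp [h.init_r, hZ0, sq_nonneg]) fun s hs hneg => by
      have h1 : p s ≤ √(Z (r s)) := Real.le_sqrt_of_sq_le (by linarith)
      have h2 := hdle (r s) (hr s hs)
      have h3 := hp s hs
      have h4 := hΛ s hs.1
      have h5 : 3 * β * p s ≤ 3 * β * √(Z (r s)) := by gcongr
      have h6 : 0 ≤ p s * (2 * (σ ^ 2 * r s ^ 2 - 2 * β ^ 2 * r s
          + 2 * β ^ 2 * lam₀ + Λ s - 3 * β * p s) - d (r s)) :=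
        mul_nonneg h3 (by linarith)
      linarith
  linarith

/-- Without forcing and with `v₀ = 0`, every profile gives the speed as a function of position:
the derivative of `p² - z(r)` is `-6βp(p - √z(r))`, which has the opposite sign. -/
lemma profile_eq_sq (h : IsPhaseTrajectory σ β lam₀ 0 (fun _ => 0) T r p) (hβ : 0 ≤ β)
    (hlam₀ : 0 < lam₀) (hc : 0 < c)
    (hq : ∀ x : ℝ, c * x ^ 2 ≤ σ ^ 2 * x ^ 2 - 2 * β ^ 2 * x + 2 * β ^ 2 * lam₀)
    {z : ℝ → ℝ} (hz : IsSpeedProfile σ β lam₀ z)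
    {t : ℝ} (h0 : 0 ≤ t) (ht : ENNReal.ofReal t < T) : z (r t) = p t ^ 2 := by
  refine le_antisymm (h.le_sq hβ hlam₀ (fun _ _ => le_rfl) le_rfl hc hq hz.init
    (fun x hx => ?_) h0 ht) ?_
  · obtain ⟨d, hd, he⟩ := hz.ode x hx
    exact ⟨d, hd, he.le⟩
  have hode := hz.ode
  choose! d hd hde using hode
  have hr : ∀ s ∈ Icc 0 t, lam₀ ≤ r s := fun s hs =>
    h.lam₀_le (fun _ _ => le_rfl) le_rfl hc hq hs.1 (ofReal_lt_of_le hs.2 ht)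
  have hp : ∀ s ∈ Icc 0 t, 0 ≤ p s := fun s hs => by
    rcases hs.1.eq_or_lt with h' | h'
    · rw [← h', h.init_p]
    · exact (h.pos hlam₀ (fun _ _ => le_rfl) le_rfl hc hq h' (ofReal_lt_of_le hs.2 ht)).le
  have := nonneg_of_hasDerivWithinAt_of_neg h0
    (fun s hs => (h.hasDerivWithinAt_sq_sub ht hr hd hs).neg)
    (by simp [h.init_r, hz.init, h.init_p]) fun s hs hneg => by
      have hneg : -(p s ^ 2 - z (r s)) < 0 := hneg
      have h3 := hp s hs
      have h1 : √(z (r s)) ≤ p s := (Real.sqrt_le_left h3).2 (by linarith)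
      have h2 := hde (r s) (hr s hs)
      have h5 : 3 * β * √(z (r s)) ≤ 3 * β * p s := by gcongr
      have h6 : 0 ≤ p s * (d (r s) - 2 * (σ ^ 2 * r s ^ 2 - 2 * β ^ 2 * r s
          + 2 * β ^ 2 * lam₀ + 0 - 3 * β * p s)) :=
        mul_nonneg h3 (by linarith)
      linarith
  have this : 0 ≤ -(p t ^ 2 - z (r t)) := this
  linarith

/-- The change of variables `x = r(t)`. -/
lemma lintegral_image (h : IsPhaseTrajectory σ β lam₀ v₀ Λ T r p) (hlam₀ : 0 < lam₀)
    (hΛ : ∀ t, 0 ≤ t → 0 ≤ Λ t) (hv₀ : 0 ≤ v₀) (hc : 0 < c)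
    (hq : ∀ x : ℝ, c * x ^ 2 ≤ σ ^ 2 * x ^ 2 - 2 * β ^ 2 * x + 2 * β ^ 2 * lam₀) (g : ℝ → ℝ≥0∞) :
    ∫⁻ x in r '' positiveTimes T, g x =
      ∫⁻ t in positiveTimes T, ENNReal.ofReal (p t) * g (r t) := by
  have hsub : positiveTimes T ⊆ {t | 0 ≤ t ∧ ENNReal.ofReal t < T} := fun s hs => ⟨hs.1.le, hs.2⟩
  rw [lintegral_image_eq_lintegral_abs_deriv_mul (f := r) (f' := p)
    (measurableSet_positiveTimes T)
    (fun t ht => (h.deriv_r t ht.1.le ht.2).mono fun s hs => hs.1.le)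
    ((h.strictMonoOn hlam₀ hΛ hv₀ hc hq).injOn.mono hsub)]
  refine setLIntegral_congr_fun (measurableSet_positiveTimes T) fun t ht => ?_
  rw [abs_of_pos (h.pos hlam₀ hΛ hv₀ hc hq ht.1 ht.2)]

lemma image_subset (h : IsPhaseTrajectory σ β lam₀ v₀ Λ T r p) (hlam₀ : 0 < lam₀)
    (hΛ : ∀ t, 0 ≤ t → 0 ≤ Λ t) (hv₀ : 0 ≤ v₀) (hc : 0 < c)
    (hq : ∀ x : ℝ, c * x ^ 2 ≤ σ ^ 2 * x ^ 2 - 2 * β ^ 2 * x + 2 * β ^ 2 * lam₀) :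
    r '' positiveTimes T ⊆ Ioi lam₀ := by
  rintro _ ⟨t, ht, rfl⟩
  rw [← h.init_r]
  exact h.strictMonoOn hlam₀ hΛ hv₀ hc hq
    ⟨le_rfl, by simpa using (zero_le).trans_lt ht.2⟩ ⟨ht.1.le, ht.2⟩ ht.1

/-- A trajectory that is everywhere at least as fast as the profile `Z` cannot live longer than
the travel time along `Z`. -/
lemma le_explosionBound (h : IsPhaseTrajectory σ β lam₀ v₀ Λ T r p) (hβ : 0 ≤ β) (hlam₀ : 0 < lam₀)
    (hΛ : ∀ t, 0 ≤ t → 0 ≤ Λ t) (hv₀ : 0 ≤ v₀) (hc : 0 < c)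
    (hq : ∀ x : ℝ, c * x ^ 2 ≤ σ ^ 2 * x ^ 2 - 2 * β ^ 2 * x + 2 * β ^ 2 * lam₀)
    (hZ0 : Z lam₀ = 0)
    (hZ : ∀ x, lam₀ ≤ x → ∃ d, HasDerivWithinAt Z d (Ici lam₀) x ∧
      1 / 2 * d + 3 * β * √(Z x) ≤ σ ^ 2 * x ^ 2 - 2 * β ^ 2 * x + 2 * β ^ 2 * lam₀) :
    T ≤ explosionBound lam₀ Z := by
  calc T = ∫⁻ t in positiveTimes T, 1 := by rw [setLIntegral_one, volume_positiveTimes]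
    _ ≤ ∫⁻ t in positiveTimes T, ENNReal.ofReal (p t) * (ENNReal.ofReal √(Z (r t)))⁻¹ := by
        refine setLIntegral_mono' (measurableSet_positiveTimes T) fun t ht => ?_
        have hp := h.pos hlam₀ hΛ hv₀ hc hq ht.1 ht.2
        have h1 : √(Z (r t)) ≤ p t :=
          (Real.sqrt_le_left hp.le).2 (h.le_sq hβ hlam₀ hΛ hv₀ hc hq hZ0 hZ ht.1.le ht.2)
        calc (1 : ℝ≥0∞) = ENNReal.ofReal (p t) * (ENNReal.ofReal (p t))⁻¹ :=
              (ENNReal.mul_inv_cancel (by simpa using hp) ENNReal.ofReal_ne_top).symm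
          _ ≤ _ := by gcongr
    _ = ∫⁻ x in r '' positiveTimes T, (ENNReal.ofReal √(Z x))⁻¹ :=
        (h.lintegral_image hlam₀ hΛ hv₀ hc hq fun x => (ENNReal.ofReal √(Z x))⁻¹).symm
    _ ≤ explosionBound lam₀ Z := lintegral_mono_set (h.image_subset hlam₀ hΛ hv₀ hc hq)

/-- The travel time along the exact profile is the lifetime of an unforced trajectory that reaches
every position. -/
lemma explosionBound_eq (h : IsPhaseTrajectory σ β lam₀ 0 (fun _ => 0) T r p) (hβ : 0 ≤ β)
    (hlam₀ : 0 < lam₀) (hc : 0 < c)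
    (hq : ∀ x : ℝ, c * x ^ 2 ≤ σ ^ 2 * x ^ 2 - 2 * β ^ 2 * x + 2 * β ^ 2 * lam₀)
    {z : ℝ → ℝ} (hz : IsSpeedProfile σ β lam₀ z) (him : Ioi lam₀ ⊆ r '' positiveTimes T) :
    explosionBound lam₀ z = T := by
  have hΛ : ∀ t : ℝ, 0 ≤ t → (0 : ℝ) ≤ (fun _ => 0 : ℝ → ℝ) t := fun _ _ => le_rfl
  rw [explosionBound, him.antisymm (h.image_subset hlam₀ hΛ le_rfl hc hq),
    h.lintegral_image hlam₀ hΛ le_rfl hc hq]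
  refine Eq.trans ?_ ((setLIntegral_one (positiveTimes T)).trans (volume_positiveTimes T))
  refine setLIntegral_congr_fun (measurableSet_positiveTimes T) fun t ht => ?_
  have hp := h.pos hlam₀ hΛ le_rfl hc hq ht.1 ht.2
  rw [h.profile_eq_sq hβ hlam₀ hc hq hz ht.1.le ht.2, Real.sqrt_sq hp.le]
  exact ENNReal.mul_inv_cancel (by simpa using hp) ENNReal.ofReal_ne_top

end IsPhaseTrajectory

/-! ### Finite travel time and explosion -/

/-- The travel time along the speed profile `k² (x - λ₀) x²` is finite: the substitution
`x = λ₀ + u²` turns the integrand into `2 / (k (λ₀ + u²))`. -/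
lemma explosionBound_cubic_lt_top {lam₀ k : ℝ} (hlam₀ : 0 < lam₀) (hk : 0 < k) :
    explosionBound lam₀ (fun x => k ^ 2 * (x - lam₀) * x ^ 2) < ⊤ := by
  have him : Ioi lam₀ = (fun u : ℝ => lam₀ + u ^ 2) '' Ioi 0 := by
    ext x
    constructor
    · intro hx
      have hx' : 0 < x - lam₀ := sub_pos.2 hx
      exact ⟨√(x - lam₀), Real.sqrt_pos.2 hx', by simp only; rw [Real.sq_sqrt hx'.le]; ring⟩
    · rintro ⟨u, hu, rfl⟩
      have hu : 0 < u := hu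
      have : 0 < u ^ 2 := by positivity
      simpa using this
  have hinj : InjOn (fun u : ℝ => lam₀ + u ^ 2) (Ioi 0) := fun u hu v hv huv => by
    have hu : 0 < u := hu
    have hv : 0 < v := hv
    have : u ^ 2 = v ^ 2 := by simpa using huv
    exact (pow_left_inj₀ hu.le hv.le two_ne_zero).1 this
  have hder : ∀ u ∈ Ioi (0 : ℝ),
      HasDerivWithinAt (fun u : ℝ => lam₀ + u ^ 2) (2 * u) (Ioi 0) u := fun u _ =>
    (((hasDerivAt_id u).pow 2).const_add lam₀).hasDerivWithinAt.congr_deriv (by simp)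
  rw [explosionBound, him, lintegral_image_eq_lintegral_abs_deriv_mul measurableSet_Ioi hder hinj]
  set C : ℝ := 2 / (k * min 1 lam₀) with hC
  have hm : 0 < min 1 lam₀ := lt_min one_pos hlam₀
  have hle : ∀ u ∈ Ioi (0 : ℝ), ENNReal.ofReal |2 * u| *
      (ENNReal.ofReal √(k ^ 2 * (lam₀ + u ^ 2 - lam₀) * (lam₀ + u ^ 2) ^ 2))⁻¹ ≤
      ENNReal.ofReal (C * (1 + u ^ 2)⁻¹) := fun u hu => by
    have hu : 0 < u := hu
    have h1 : √(k ^ 2 * (lam₀ + u ^ 2 - lam₀) * (lam₀ + u ^ 2) ^ 2) = k * u * (lam₀ + u ^ 2) := by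
      rw [show k ^ 2 * (lam₀ + u ^ 2 - lam₀) * (lam₀ + u ^ 2) ^ 2
        = (k * u * (lam₀ + u ^ 2)) ^ 2 by ring]
      exact Real.sqrt_sq (by positivity)
    have h2 : 0 < k * u * (lam₀ + u ^ 2) := by positivity
    rw [h1, ← ENNReal.ofReal_inv_of_pos h2, ← ENNReal.ofReal_mul (abs_nonneg _),
      abs_of_pos (by positivity)]
    refine ENNReal.ofReal_le_ofReal ?_
    have h3 : min 1 lam₀ * (1 + u ^ 2) ≤ lam₀ + u ^ 2 := by
      nlinarith [min_le_left 1 lam₀, min_le_right 1 lam₀, sq_nonneg u]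
    calc 2 * u * (k * u * (lam₀ + u ^ 2))⁻¹ = 2 / (k * (lam₀ + u ^ 2)) := by field_simp
      _ ≤ 2 / (k * (min 1 lam₀ * (1 + u ^ 2))) := by gcongr
      _ = C * (1 + u ^ 2)⁻¹ := by rw [hC]; field_simp
  refine (setLIntegral_mono' measurableSet_Ioi hle).trans_lt ?_
  refine (setLIntegral_le_lintegral _ _).trans_lt ?_
  exact (integrable_inv_one_add_sq.const_mul C).lintegral_lt_top

/-- If `σ² x² - 2β² x + 2β² λ₀ ≥ c x²` then `k² (x - λ₀) x²` is, for small `k`, a subsolution of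
the profile equation. -/
lemma exists_cubic_subsolution {σ β lam₀ c : ℝ} (hβ : 0 ≤ β) (hlam₀ : 0 < lam₀) (hc : 0 < c)
    (hq : ∀ x : ℝ, c * x ^ 2 ≤ σ ^ 2 * x ^ 2 - 2 * β ^ 2 * x + 2 * β ^ 2 * lam₀) :
    ∃ k > 0, ∀ x, lam₀ ≤ x → ∃ d,
      HasDerivWithinAt (fun x => k ^ 2 * (x - lam₀) * x ^ 2) d (Ici lam₀) x ∧
      1 / 2 * d + 3 * β * √(k ^ 2 * (x - lam₀) * x ^ 2) ≤
        σ ^ 2 * x ^ 2 - 2 * β ^ 2 * x + 2 * β ^ 2 * lam₀ := by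
  have hs : 0 < √lam₀ := Real.sqrt_pos.2 hlam₀
  set A : ℝ := 3 / 2 + 3 * β / √lam₀ with hA
  have hA0 : 0 < A := by positivity
  refine ⟨min 1 (c / A), lt_min one_pos (by positivity), fun x hx => ?_⟩
  set k := min 1 (c / A) with hk
  have hk0 : 0 < k := lt_min one_pos (by positivity)
  have hx0 : 0 < x := hlam₀.trans_le hx
  refine ⟨k ^ 2 * (x ^ 2 + (x - lam₀) * (2 * x)), ?_, ?_⟩
  · refine HasDerivAt.hasDerivWithinAt ?_
    have h1 := (((hasDerivAt_id x).sub_const lam₀).const_mul (k ^ 2)).mul ((hasDerivAt_id x).pow 2)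
    exact h1.congr_deriv (by simp; ring)
  · have h1 : √(k ^ 2 * (x - lam₀) * x ^ 2) = k * (√(x - lam₀) * x) := by
      rw [show k ^ 2 * (x - lam₀) * x ^ 2 = (k * x) ^ 2 * (x - lam₀) by ring,
        Real.sqrt_mul (sq_nonneg _), Real.sqrt_sq (by positivity)]
      ring
    have h2 : √(x - lam₀) ≤ x / √lam₀ := by
      rw [le_div_iff₀ hs, ← Real.sqrt_mul (by linarith), Real.sqrt_le_left hx0.le]
      nlinarith
    have h3 : k ^ 2 * (x ^ 2 + (x - lam₀) * (2 * x)) ≤ k * (3 * x ^ 2) := by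
      have : k ^ 2 ≤ k := by
        rw [sq]; exact mul_le_of_le_one_left hk0.le (min_le_left _ _)
      have h4 : x ^ 2 + (x - lam₀) * (2 * x) ≤ 3 * x ^ 2 := by nlinarith
      have h5 : 0 ≤ (x - lam₀) * (2 * x) := mul_nonneg (by linarith) (by linarith)
      gcongr
    have h6 : k * A ≤ c := by
      rw [← le_div_iff₀ hA0]; exact min_le_right _ _
    rw [h1]
    calc 1 / 2 * (k ^ 2 * (x ^ 2 + (x - lam₀) * (2 * x))) + 3 * β * (k * (√(x - lam₀) * x))
        ≤ 1 / 2 * (k * (3 * x ^ 2)) + 3 * β * (k * (x / √lam₀ * x)) := by gcongr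
      _ = k * A * x ^ 2 := by rw [hA]; ring
      _ ≤ c * x ^ 2 := by gcongr
      _ ≤ _ := hq x

/-- A subsolution with finite travel time forces explosion, and the short rate diverges because it
increases and is unbounded. -/
lemma explosion_of_subsolution {σ β lam₀ c : ℝ} (hβ : 0 ≤ β) (hlam₀ : 0 < lam₀) (hc : 0 < c)
    (hq : ∀ x : ℝ, c * x ^ 2 ≤ σ ^ 2 * x ^ 2 - 2 * β ^ 2 * x + 2 * β ^ 2 * lam₀)
    {Z : ℝ → ℝ} (hZ0 : Z lam₀ = 0)
    (hZ : ∀ x, lam₀ ≤ x → ∃ d, HasDerivWithinAt Z d (Ici lam₀) x ∧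
      1 / 2 * d + 3 * β * √(Z x) ≤ σ ^ 2 * x ^ 2 - 2 * β ^ 2 * x + 2 * β ^ 2 * lam₀)
    (hfin : explosionBound lam₀ Z < ⊤) {lam : ℝ → ℝ} {v₀ : ℝ}
    (hlam : IsTwiceDifferentiableCurve lam) (hl0 : lam 0 = lam₀)
    (hΛ : ∀ t : ℝ, 0 ≤ t → 0 ≤ bigLambda β lam t) (hv₀ : 0 ≤ v₀) :
    explosionTime σ β lam v₀ ≤ explosionBound lam₀ Z ∧
      ∃ r : ℝ → ℝ, IsMaximalRateSolution σ β lam v₀ r ∧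
        Tendsto r (𝓝[<] (explosionTime σ β lam v₀).toReal) atTop := by
  obtain ⟨r, hr, hunb⟩ := exists_isMaximalRateSolution (σ := σ) hβ hlam v₀
  obtain ⟨p, hp⟩ := hr.2.1.exists_isPhaseTrajectory
  rw [hl0] at hp
  have hle := hp.le_explosionBound hβ hlam₀ hΛ hv₀ hc hq hZ0 hZ
  have htop : explosionTime σ β lam v₀ ≠ ⊤ := (hle.trans_lt hfin).ne
  refine ⟨hle, r, hr, tendsto_atTop.2 fun M => ?_⟩
  obtain ⟨t, h0, ht, hM⟩ := hunb htop M
  have hta : t < (explosionTime σ β lam v₀).toReal := (ENNReal.ofReal_lt_iff_lt_toReal h0 htop).1 ht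
  rw [abs_of_nonneg (hlam₀.le.trans (hp.lam₀_le hΛ hv₀ hc hq h0 ht))] at hM
  filter_upwards [Ioo_mem_nhdsLT hta] with s hs
  have hsτ : ENNReal.ofReal s < explosionTime σ β lam v₀ :=
    (ENNReal.ofReal_lt_iff_lt_toReal (h0.trans hs.1.le) htop).2 hs.2
  exact hM.le.trans ((hp.strictMonoOn hlam₀ hΛ hv₀ hc hq) ⟨h0, ht⟩ ⟨h0.trans hs.1.le, hsτ⟩ hs.1).le

/-! ### The speed profile -/

namespace IsPhaseTrajectory

variable {σ β lam₀ v₀ c : ℝ} {Λ r p : ℝ → ℝ}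

/-- A trajectory that diverges as `t ↑ a` takes every value from its initial value on. -/
lemma exists_eq_of_tendsto {a : ℝ} (ha : 0 < a)
    (h : IsPhaseTrajectory σ β lam₀ v₀ Λ (ENNReal.ofReal a) r p)
    (hlim : Tendsto r (𝓝[<] a) atTop) {x : ℝ} (hx : lam₀ ≤ x) :
    ∃ t, 0 ≤ t ∧ t < a ∧ r t = x := by
  obtain ⟨t, hxt, ht⟩ := ((hlim.eventually_ge_atTop x).and (Ioo_mem_nhdsLT ha)).exists
  have hc : ContinuousOn r (Icc 0 t) := fun s hs =>
    (h.hasDerivWithinAt_r ((ENNReal.ofReal_lt_ofReal_iff ha).2 ht.2) s hs).continuousWithinAt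
  obtain ⟨s, hs, hsx⟩ := intermediate_value_Icc ht.1.le hc ⟨by rwa [h.init_r], hxt⟩
  exact ⟨s, hs.1, hs.2.trans_lt ht.2, hsx⟩

/-- The squared speed, as a function of position, of an unforced trajectory that diverges is a
speed profile. -/
lemma exists_isSpeedProfile {a : ℝ} (ha : 0 < a)
    (h : IsPhaseTrajectory σ β lam₀ 0 (fun _ => 0) (ENNReal.ofReal a) r p) (hlam₀ : 0 < lam₀)
    (hc : 0 < c) (hq : ∀ x : ℝ, c * x ^ 2 ≤ σ ^ 2 * x ^ 2 - 2 * β ^ 2 * x + 2 * β ^ 2 * lam₀)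
    (hlim : Tendsto r (𝓝[<] a) atTop) :
    ∃ y, IsSpeedProfile σ β lam₀ y ∧ ∀ x, lam₀ < x → 0 < y x := by
  have hlt : ∀ t, t < a → ENNReal.ofReal t < ENNReal.ofReal a := fun t ht =>
    (ENNReal.ofReal_lt_ofReal_iff ha).2 ht
  have hmono := h.strictMonoOn hlam₀ (fun _ _ => le_rfl) le_rfl hc hq
  have hpos : ∀ t, 0 < t → t < a → 0 < p t := fun t h0 ht =>
    h.pos hlam₀ (fun _ _ => le_rfl) le_rfl hc hq h0 (hlt t ht)
  have hex := fun x hx => h.exists_eq_of_tendsto ha hlim (x := x) hx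
  choose! g hg0 hga hrg using hex
  have hgmem : ∀ x, lam₀ ≤ x → g x ∈ {t | 0 ≤ t ∧ ENNReal.ofReal t < ENNReal.ofReal a} :=
    fun x hx => ⟨hg0 x hx, hlt _ (hga x hx)⟩
  have hgr : ∀ t, 0 ≤ t → t < a → lam₀ ≤ r t ∧ g (r t) = t := fun t h0 ht => by
    have hle := h.lam₀_le (fun _ _ => le_rfl) le_rfl hc hq h0 (hlt t ht)
    exact ⟨hle, hmono.injOn (hgmem _ hle) ⟨h0, hlt t ht⟩ (hrg _ hle)⟩
  have hgmono : StrictMonoOn g (Ici lam₀) := fun x hx z hz hxz => by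
    rw [← hmono.lt_iff_lt (hgmem x hx) (hgmem z hz), hrg x hx, hrg z hz]
    exact hxz
  have hgl : g lam₀ = 0 := by
    have := (hgr 0 le_rfl ha).2
    rwa [h.init_r] at this
  have hgpos : ∀ x, lam₀ < x → 0 < g x := fun x hx => by
    rw [← hgl]; exact hgmono (mem_Ici.2 le_rfl) hx.le hx
  have hgc : ∀ x, lam₀ < x → ContinuousAt g x := fun x hx => by
    refine (hgmono.mono Ioi_subset_Ici_self).continuousAt_of_image_mem_nhds (Ioi_mem_nhds hx) ?_
    refine mem_of_superset (Ioo_mem_nhds (hgpos x hx) (hga x hx.le)) fun t ht => ?_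
    refine ⟨r t, ?_, (hgr t ht.1.le ht.2).2⟩
    rw [mem_Ioi, ← h.init_r]
    exact hmono ⟨le_rfl, hlt 0 ha⟩ ⟨ht.1.le, hlt t ht.2⟩ ht.1
  have hgc0 : ContinuousWithinAt g (Ici lam₀) lam₀ := by
    refine hgmono.continuousWithinAt_right_of_image_mem_nhdsWithin self_mem_nhdsWithin ?_
    rw [hgl]
    exact mem_of_superset (Ico_mem_nhdsGE ha) fun t ht =>
      ⟨r t, (hgr t ht.1 ht.2).1, (hgr t ht.1 ht.2).2⟩
  have hp0 : ∀ x, lam₀ ≤ x → 0 ≤ p (g x) := fun x hx => by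
    rcases hx.eq_or_lt with rfl | hx
    · rw [hgl, h.init_p]
    · exact (hpos _ (hgpos x hx) (hga x hx.le)).le
  have hder : ∀ x, lam₀ < x → HasDerivAt (fun x => p (g x) ^ 2)
      (2 * (σ ^ 2 * x ^ 2 - 2 * β ^ 2 * x + 2 * β ^ 2 * lam₀ - 3 * β * p (g x))) x := fun x hx => by
    have hI : Ici 0 ∈ 𝓝 (g x) := Ici_mem_nhds (hgpos x hx)
    have hne := (hpos _ (hgpos x hx) (hga x hx.le)).ne'
    have h1 := (h.deriv_r _ (hg0 x hx.le) (hlt _ (hga x hx.le))).hasDerivAt hI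
    have h2 := (h.deriv_p _ (hg0 x hx.le) (hlt _ (hga x hx.le))).hasDerivAt hI
    have h3 : HasDerivAt g (p (g x))⁻¹ x := h1.of_local_left_inverse (hgc x hx) hne
      (eventually_of_mem (Ioi_mem_nhds hx) fun z hz => hrg z (le_of_lt hz))
    refine ((h2.comp x h3).pow 2).congr_deriv ?_
    simp only [Function.comp_apply, hrg x hx.le]
    field_simp
    push_cast
    ring
  have hpc : ContinuousWithinAt (fun x => p (g x)) (Ici lam₀) lam₀ := by
    have h1 : ContinuousWithinAt p (Ici 0) (g lam₀) :=
      (h.deriv_p _ (hg0 _ le_rfl) (hlt _ (hga _ le_rfl))).continuousWithinAt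
    exact h1.comp hgc0 fun x hx => hg0 x hx
  have hpc' : Tendsto (fun x => p (g x)) (𝓝[>] lam₀) (𝓝 (p (g lam₀))) :=
    hpc.mono Ioi_subset_Ici_self
  have hder0 : HasDerivWithinAt (fun x => p (g x) ^ 2)
      (2 * (σ ^ 2 * lam₀ ^ 2 - 2 * β ^ 2 * lam₀ + 2 * β ^ 2 * lam₀ - 3 * β * p (g lam₀)))
      (Ici lam₀) lam₀ := by
    refine hasDerivWithinAt_Ici_of_tendsto_deriv (s := Ioi lam₀)
      (fun x hx => (hder x hx).differentiableAt.differentiableWithinAt)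
      ((hpc.pow 2).mono Ioi_subset_Ici_self) self_mem_nhdsWithin ?_
    have hx : Tendsto (fun x : ℝ => x) (𝓝[>] lam₀) (𝓝 lam₀) := nhdsWithin_le_nhds
    refine Tendsto.congr' (eventually_of_mem self_mem_nhdsWithin
      fun x hx => (hder x hx).deriv.symm) ?_
    exact (((((hx.pow 2).const_mul _).sub (hx.const_mul _)).add_const _).sub
      (hpc'.const_mul _)).const_mul _
  refine ⟨fun x => p (g x) ^ 2, ⟨by simp [hgl, h.init_p], fun x _ => sq_nonneg _, fun x hx =>
    ⟨2 * (σ ^ 2 * x ^ 2 - 2 * β ^ 2 * x + 2 * β ^ 2 * lam₀ - 3 * β * p (g x)), ?_, ?_⟩⟩,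
    fun x hx => pow_pos (hpos _ (hgpos x hx) (hga x hx.le)) 2⟩
  · rcases hx.eq_or_lt with rfl | hx
    · exact hder0
    · exact (hder x hx).hasDerivWithinAt
  · rw [Real.sqrt_sq (hp0 x hx)]; ring

end IsPhaseTrajectory

/-! ### Convergence above the critical mean reversion -/

/-- The factorization of `σ² x² - 2β² x + 2β² λ₀`, whose smaller zero exceeds `λ₀`. -/
lemma exists_factorization_of_criticalBeta_le {σ β lam₀ : ℝ} (hσ : 0 < σ) (hlam₀ : 0 < lam₀)
    (h : criticalBeta σ lam₀ ≤ β) : 0 < β ∧ lam₀ < lowerFixedPoint σ β lam₀ ∧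
      ∃ x₂, lowerFixedPoint σ β lam₀ ≤ x₂ ∧
        σ ^ 2 * (lowerFixedPoint σ β lam₀ + x₂) = 2 * β ^ 2 ∧
        ∀ x, σ ^ 2 * x ^ 2 - 2 * β ^ 2 * x + 2 * β ^ 2 * lam₀ =
          σ ^ 2 * ((lowerFixedPoint σ β lam₀ - x) * (x₂ - x)) := by
  have hcrit : 0 < criticalBeta σ lam₀ := by unfold criticalBeta; positivity
  have hβ : 0 < β := hcrit.trans_le h
  have h1 : σ ^ 2 * (2 * lam₀) ≤ β ^ 2 := by
    have := pow_le_pow_left₀ hcrit.le h 2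
    rwa [criticalBeta, mul_pow, Real.sq_sqrt (by positivity)] at this
  set D := √(1 - 2 * σ ^ 2 * lam₀ / β ^ 2) with hD
  have hD0 : 0 ≤ D := Real.sqrt_nonneg _
  have hD2 : D ^ 2 = 1 - 2 * σ ^ 2 * lam₀ / β ^ 2 := by
    refine Real.sq_sqrt ?_
    rw [sub_nonneg, div_le_one (by positivity)]
    linarith
  have hx1 : lowerFixedPoint σ β lam₀ = β ^ 2 / σ ^ 2 * (1 - D) := rfl
  have hle : lowerFixedPoint σ β lam₀ ≤ β ^ 2 / σ ^ 2 * (1 + D) := by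
    rw [hx1]; gcongr; linarith
  have hsum : σ ^ 2 * (lowerFixedPoint σ β lam₀ + β ^ 2 / σ ^ 2 * (1 + D)) = 2 * β ^ 2 := by
    rw [hx1]; field_simp; ring
  have hprod : σ ^ 2 * (lowerFixedPoint σ β lam₀ * (β ^ 2 / σ ^ 2 * (1 + D)))
      = 2 * β ^ 2 * lam₀ := by
    have : σ ^ 2 * (lowerFixedPoint σ β lam₀ * (β ^ 2 / σ ^ 2 * (1 + D)))
        = β ^ 4 / σ ^ 2 * (1 - D ^ 2) := by rw [hx1]; field_simp; ring
    rw [this, hD2]; field_simp; ring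
  generalize lowerFixedPoint σ β lam₀ = x₁ at *
  generalize β ^ 2 / σ ^ 2 * (1 + D) = x₂ at *
  have hσ2 : 0 < σ ^ 2 := by positivity
  have hfac : ∀ x, σ ^ 2 * x ^ 2 - 2 * β ^ 2 * x + 2 * β ^ 2 * lam₀ =
      σ ^ 2 * ((x₁ - x) * (x₂ - x)) := fun x => by
    linear_combination x * hsum - hprod
  refine ⟨hβ, ?_, x₂, hle, hsum, hfac⟩
  -- the vertex `β² / σ²` is at least `2λ₀`, so `λ₀` cannot lie above both zeros
  have hx2 : lam₀ < x₂ := by nlinarith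
  have h0 : 0 < σ ^ 2 * ((x₁ - lam₀) * (x₂ - lam₀)) := by
    rw [← hfac]
    have : 0 < σ ^ 2 * lam₀ ^ 2 := by positivity
    linarith
  have h3 := pos_of_mul_pos_right h0 hσ2.le
  linarith [pos_of_mul_pos_left h3 (sub_pos.2 hx2).le]

/-- A continuous function is positive if it has no first zero. -/
lemma pos_of_forall_lt_pos {f : ℝ → ℝ} {t : ℝ} (ht : 0 ≤ t) (hf : ContinuousOn f (Icc 0 t))
    (h : ∀ s ∈ Icc 0 t, (∀ u ∈ Ico 0 s, 0 < f u) → 0 < f s) : 0 < f t := by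
  by_contra! hlt
  have hcpt : IsCompact (Icc 0 t ∩ f ⁻¹' Iic 0) :=
    isCompact_Icc.of_isClosed_subset (hf.preimage_isClosed_of_isClosed isClosed_Icc isClosed_Iic)
      inter_subset_left
  obtain ⟨m, ⟨hm, hfm⟩, hmin⟩ := hcpt.exists_isLeast ⟨t, right_mem_Icc.2 ht, hlt⟩
  refine absurd (h m hm fun u hu => ?_) (not_lt.2 hfm)
  by_contra! hu'
  exact absurd (hmin ⟨⟨hu.1, hu.2.le.trans hm.2⟩, hu'⟩) (not_le.2 hu.2)

namespace IsPhaseTrajectory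

variable {σ β lam₀ x₁ x₂ : ℝ} {r p : ℝ → ℝ} {T : ℝ≥0∞}

/-- The triangle `r ≥ λ₀`, `0 ≤ p < β (x₁ - r)` is not left. With `a = x₁ - r` and
`b = β a - p`, the equation reads `a' + β a = b` and `b' + 2β b = σ² (x₁ + r) a`, so neither of
`a` and `b` can be the first to vanish. -/
lemma mem_triangle (h : IsPhaseTrajectory σ β lam₀ 0 (fun _ => 0) T r p) (hβ : 0 < β)
    (hlam₀ : 0 < lam₀) (hx₁ : lam₀ < x₁) (hx₂ : x₁ ≤ x₂) (hsum : σ ^ 2 * (x₁ + x₂) = 2 * β ^ 2)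
    (hfac : ∀ x, σ ^ 2 * x ^ 2 - 2 * β ^ 2 * x + 2 * β ^ 2 * lam₀ = σ ^ 2 * ((x₁ - x) * (x₂ - x)))
    {t : ℝ} (h0 : 0 ≤ t) (ht : ENNReal.ofReal t < T) :
    lam₀ ≤ r t ∧ 0 ≤ p t ∧ p t < β * (x₁ - r t) := by
  have key : ∀ s ∈ Icc 0 t, (∀ u ∈ Ico 0 s, 0 < β * (x₁ - r u) - p u) →
      lam₀ ≤ r s ∧ 0 ≤ p s ∧ 0 < β * (x₁ - r s) - p s := by
    intro s hs hb
    have hlt : ∀ u ≤ s, ENNReal.ofReal u < T := fun u hu => ofReal_lt_of_le (hu.trans hs.2) ht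
    have ha : ∀ u ∈ Icc 0 s, 0 < x₁ - r u := fun u hu => by
      have := le_exp_mul_of_hasDerivWithinAt (f := fun v => x₁ - r v)
        (g := fun v => β * (x₁ - r v) - p v) (a := β) hu.1
        (fun v hv => ((h.hasDerivWithinAt_r (hlt u hu.2) v hv).const_sub x₁).congr_deriv (by ring))
        (fun v hv => (hb v ⟨hv.1.le, hv.2.trans_le hu.2⟩).le)
      simp only [h.init_r] at this
      exact pos_of_mul_pos_right ((sub_pos.2 hx₁).trans_le this) (Real.exp_pos _).le
    have hp : ∀ u ∈ Icc 0 s, 0 ≤ p u := fun u hu =>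
      h.nonneg le_rfl hu.1 (hlt u hu.2) fun v hv => by
        have h1 := ha v ⟨hv.1.le, hv.2.le.trans hu.2⟩
        rw [hfac, add_zero]
        have h2 : 0 ≤ x₂ - r v := by linarith
        positivity
    have hr : ∀ u ∈ Icc 0 s, lam₀ ≤ r u := fun u hu => by
      rw [← h.init_r]
      exact h.le_of_nonneg le_rfl hu.1 (hlt u hu.2) fun v hv => hp v ⟨hv.1.le, hv.2.le.trans hu.2⟩
    refine ⟨hr s ⟨hs.1, le_rfl⟩, hp s ⟨hs.1, le_rfl⟩, ?_⟩
    have hbs := le_exp_mul_of_hasDerivWithinAt (f := fun v => β * (x₁ - r v) - p v)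
      (g := fun v => σ ^ 2 * ((x₁ + r v) * (x₁ - r v))) (a := 2 * β) hs.1
      (fun v hv => (((h.hasDerivWithinAt_r (hlt s le_rfl) v hv).const_sub x₁).const_mul β |>.sub
        (h.hasDerivWithinAt_p (hlt s le_rfl) v hv)).congr_deriv (by
          rw [hfac]; linear_combination (r v - x₁) * hsum))
      (fun v hv => by
        have h1 := ha v ⟨hv.1.le, hv.2.le⟩
        have h2 := hr v ⟨hv.1.le, hv.2.le⟩
        have h3 : 0 ≤ x₁ + r v := by linarith
        positivity)
    simp only [h.init_r, h.init_p, sub_zero] at hbs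
    have h1 : 0 < β * (x₁ - lam₀) := mul_pos hβ (sub_pos.2 hx₁)
    exact pos_of_mul_pos_right (h1.trans_le hbs) (Real.exp_pos _).le
  have hcont : ContinuousOn (fun s => β * (x₁ - r s) - p s) (Icc 0 t) := fun s hs =>
    ((((h.hasDerivWithinAt_r ht s hs).const_sub x₁).const_mul β).sub
      (h.hasDerivWithinAt_p ht s hs)).continuousWithinAt
  have hpos : ∀ u, 0 ≤ u → u ≤ t → 0 < β * (x₁ - r u) - p u := fun u hu0 hut =>
    pos_of_forall_lt_pos (f := fun s => β * (x₁ - r s) - p s) hu0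
      (hcont.mono (Icc_subset_Icc le_rfl hut))
      fun s hs hb => (key s ⟨hs.1, hs.2.trans hut⟩ hb).2.2
  obtain ⟨h1, h2, h3⟩ := key t ⟨h0, le_rfl⟩ fun u hu => hpos u hu.1 hu.2.le
  exact ⟨h1, h2, by linarith⟩

/-- A trajectory that increases below `x₁` converges to `x₁`: if it stayed below some `l < x₁`,
then `p + 3β r` would grow at least linearly. -/
lemma tendsto_of_mem_triangle (h : IsPhaseTrajectory σ β lam₀ 0 (fun _ => 0) ⊤ r p) (hσ : 0 < σ)
    (hβ : 0 < β) (hx₂ : x₁ ≤ x₂)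
    (hfac : ∀ x, σ ^ 2 * x ^ 2 - 2 * β ^ 2 * x + 2 * β ^ 2 * lam₀ = σ ^ 2 * ((x₁ - x) * (x₂ - x)))
    (htri : ∀ t, 0 ≤ t → 0 ≤ p t ∧ p t < β * (x₁ - r t)) : Tendsto r atTop (𝓝 x₁) := by
  have htop : ∀ t : ℝ, ENNReal.ofReal t < ⊤ := fun t => ENNReal.ofReal_lt_top
  have hlt : ∀ t, 0 ≤ t → r t < x₁ := fun t h0 => by
    have := (htri t h0).1.trans_lt (htri t h0).2
    linarith [pos_of_mul_pos_right this hβ.le]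
  refine tendsto_order.2 ⟨fun l hl => ?_, fun u hu => ?_⟩
  · obtain ⟨t, h0, ht⟩ : ∃ t, 0 ≤ t ∧ l < r t := by
      by_contra! hcon
      set δ := σ ^ 2 * (x₁ - l) ^ 2 with hδ
      have hδ0 : 0 < δ := by have := sub_pos.2 hl; positivity
      have hbd : ∀ t, 0 ≤ t → δ * t ≤ 3 * β * (x₁ - lam₀) := fun t h0 => by
        have hd : ∀ s ∈ Icc 0 t, HasDerivWithinAt (fun s => p s + 3 * β * r s - δ * s)
            (σ ^ 2 * ((x₁ - r s) * (x₂ - r s)) - δ) (Icc 0 t) s := fun s hs =>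
          (((h.hasDerivWithinAt_p (htop t) s hs).add
            ((h.hasDerivWithinAt_r (htop t) s hs).const_mul (3 * β))).sub
            ((hasDerivWithinAt_id s _).const_mul δ)).congr_deriv (by rw [hfac]; ring)
        have := monotoneOn_of_hasDerivWithinAt_nonneg (convex_Icc 0 t)
          (fun s hs => (hd s hs).continuousWithinAt)
          (fun s hs => (hd s (interior_subset hs)).mono interior_subset)
          (fun s hs => by
            have h1 := hcon s (interior_subset hs).1
            have h2 : (x₁ - l) ^ 2 ≤ (x₁ - r s) * (x₂ - r s) := by
              rw [sq]
              exact mul_le_mul (by linarith) (by linarith) (by linarith) (by linarith)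
            rw [hδ, sub_nonneg]
            gcongr) (left_mem_Icc.2 h0) (right_mem_Icc.2 h0) h0
        simp only [h.init_r, h.init_p, mul_zero, sub_zero, zero_add] at this
        have h1 := htri t h0
        have h2 : β * r t ≤ β * x₁ := by have := (hlt t h0).le; gcongr
        linarith [h1.2]
      have hx : 0 ≤ x₁ - lam₀ := by
        have := hlt 0 le_rfl
        rw [h.init_r] at this
        linarith
      have := hbd ((3 * β * (x₁ - lam₀) + 1) / δ) (by positivity)
      rw [mul_div_cancel₀ _ hδ0.ne'] at this
      linarith
    filter_upwards [eventually_ge_atTop t] with s hs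
    exact ht.trans_le (h.le_of_nonneg h0 hs (htop s) fun u hu => (htri u hu.1.le).1)
  · filter_upwards [eventually_ge_atTop 0] with s hs
    exact (hlt s hs).trans hu

end IsPhaseTrajectory

/-! ### The explosion criterion -/

theorem mainTheorem2 (σ β lam₀ : ℝ) (hσ : 0 < σ) (hβ : 0 ≤ β) (hlam₀ : 0 < lam₀) :
    -- the short rate of the two-dimensional system is the solution with `r'(0) = λ'(0)`
    (∀ lam : ℝ → ℝ, IsTwiceDifferentiableCurve lam → ∀ (T : ℝ≥0∞) (r : ℝ → ℝ),
      (∃ y : ℝ → ℝ, IsShortRateSystem σ β lam T r y) ↔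
        IsRateSolution σ β lam (derivWithin lam (Ici 0) 0) T r) ∧
    -- (i)
    (β < criticalBeta σ lam₀ →
      ∃ y : ℝ → ℝ, IsSpeedProfile σ β lam₀ y ∧
        (∀ z : ℝ → ℝ, IsSpeedProfile σ β lam₀ z → EqOn z y (Ici lam₀)) ∧
        (∀ x : ℝ, lam₀ < x → 0 < y x) ∧
        explosionBound lam₀ y < ⊤ ∧
        (∀ (lam : ℝ → ℝ) (v₀ : ℝ), IsTwiceDifferentiableCurve lam → lam 0 = lam₀ →
          (∀ t : ℝ, 0 ≤ t → 0 ≤ bigLambda β lam t) → 0 ≤ v₀ →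
          explosionTime σ β lam v₀ ≤ explosionBound lam₀ y ∧
          ∃ r : ℝ → ℝ, IsMaximalRateSolution σ β lam v₀ r ∧
            Tendsto r (𝓝[<] (explosionTime σ β lam v₀).toReal) atTop) ∧
        explosionTime σ β (fun _ => lam₀) 0 = explosionBound lam₀ y) ∧
    -- (ii)
    (criticalBeta σ lam₀ ≤ β →
      explosionTime σ β (fun _ => lam₀) 0 = ⊤ ∧
      ∃ r : ℝ → ℝ, IsMaximalRateSolution σ β (fun _ => lam₀) 0 r ∧
        Tendsto r atTop (𝓝 (lowerFixedPoint σ β lam₀))) := by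
  have hconst := isTwiceDifferentiableCurve_const lam₀
  have hΛ : bigLambda β (fun _ => lam₀) = fun _ => 0 := funext (bigLambda_const β lam₀)
  refine ⟨fun lam hlam T r => exists_isShortRateSystem_iff hlam T r, fun hcrit => ?_,
    fun hcrit => ?_⟩
  · obtain ⟨c, hc, hq⟩ := exists_mul_sq_le_of_lt_criticalBeta hβ hlam₀ hcrit
    obtain ⟨k, hk, hZ⟩ := exists_cubic_subsolution hβ hlam₀ hc hq
    have hZfin := explosionBound_cubic_lt_top hlam₀ hk
    obtain ⟨hle, r, hr, hlim⟩ := explosion_of_subsolution hβ hlam₀ hc hq (by simp) hZ hZfin hconst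
      rfl (fun t _ => (bigLambda_const β lam₀ t).ge) (le_refl 0)
    obtain ⟨p, hp⟩ := hr.2.1.exists_isPhaseTrajectory
    rw [hΛ] at hp
    set τ := explosionTime σ β (fun _ => lam₀) 0
    have hτ : τ ≠ ⊤ := (hle.trans_lt hZfin).ne
    have ha : 0 < τ.toReal := ENNReal.toReal_pos hr.1.ne' hτ
    have hτa : τ = ENNReal.ofReal τ.toReal := (ENNReal.ofReal_toReal hτ).symm
    have hpa : IsPhaseTrajectory σ β lam₀ 0 (fun _ => 0) (ENNReal.ofReal τ.toReal) r p := by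
      rw [← hτa]; exact hp
    have hsurj := fun x (hx : lam₀ ≤ x) => hpa.exists_eq_of_tendsto ha hlim hx
    have hlt : ∀ t, t < τ.toReal → ENNReal.ofReal t < τ := fun t ht => by
      rw [hτa]; exact (ENNReal.ofReal_lt_ofReal_iff ha).2 ht
    obtain ⟨y, hy, hypos⟩ := hpa.exists_isSpeedProfile ha hlam₀ hc hq hlim
    have him : Ioi lam₀ ⊆ r '' positiveTimes τ := fun x hx => by
      obtain ⟨t, h0, hta, rfl⟩ := hsurj x (le_of_lt hx)
      refine ⟨t, ⟨h0.lt_of_ne ?_, hlt t hta⟩, rfl⟩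
      rintro rfl
      rw [hp.init_r] at hx
      exact lt_irrefl _ (mem_Ioi.1 hx)
    have heq := hp.explosionBound_eq hβ hlam₀ hc hq hy him
    have hfin : explosionBound lam₀ y < ⊤ := by rw [heq]; exact hτ.lt_top
    refine ⟨y, hy, fun z hz x hx => ?_, hypos, hfin, fun lam v₀ hlam hl0 hL hv₀ => ?_, heq.symm⟩
    · obtain ⟨t, h0, hta, rfl⟩ := hsurj x hx
      rw [hp.profile_eq_sq hβ hlam₀ hc hq hz h0 (hlt t hta),
        hp.profile_eq_sq hβ hlam₀ hc hq hy h0 (hlt t hta)]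
    · refine explosion_of_subsolution hβ hlam₀ hc hq hy.init (fun x hx => ?_) hfin hlam hl0 hL hv₀
      obtain ⟨d, hd, he⟩ := hy.ode x hx
      exact ⟨d, hd, he.le⟩
  · obtain ⟨hβ', hx₁, x₂, hx₂, hsum, hfac⟩ :=
      exists_factorization_of_criticalBeta_le hσ hlam₀ hcrit
    obtain ⟨r, hr, hunb⟩ := exists_isMaximalRateSolution (σ := σ) hβ hconst 0
    obtain ⟨p, hp⟩ := hr.2.1.exists_isPhaseTrajectory
    rw [hΛ] at hp
    have htri := fun t h0 ht => hp.mem_triangle hβ' hlam₀ hx₁ hx₂ hsum hfac (t := t) h0 ht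
    have hτ : explosionTime σ β (fun _ => lam₀) 0 = ⊤ := by
      by_contra hne
      obtain ⟨t, h0, ht, hlt⟩ := hunb hne (lowerFixedPoint σ β lam₀)
      obtain ⟨h1, h2, h3⟩ := htri t h0 ht
      rw [abs_of_nonneg (hlam₀.le.trans h1)] at hlt
      linarith [pos_of_mul_pos_right (h2.trans_lt h3) hβ]
    rw [hτ] at hp htri
    exact ⟨hτ, r, hr, hp.tendsto_of_mem_triangle hσ hβ' hx₂ hfac
      fun t h0 => (htri t h0 ENNReal.ofReal_lt_top).2⟩
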